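/- Let $T$ be a complete first-order theory in a language $L$, let $\kappa>\aleph_0+|L|$ be a cardinal, and let $\mathfrak C$ be a $\kappa$-saturated model of $T$ (for instance a saturated model of cardinality $\kappa$). Let $A\subseteq\mathfrak C$ with $|A|<\kappa$, and let $\mathfrak p$ be a global type, i.e. a complete type in one variable over $\mathfrak C$. For $B\subseteq\mathfrak C$ let $\mathfrak p_{\restriction B}$ be the set of formulas over $B$ in $\mathfrak p$. Definitions. $\mathfrak p$ is *$A$-invariant* if $\varphi(\bar b_1,x)\in\mathfrak p\Leftrightarrow\varphi(\bar b_2,x)\in\mathfrak p$ for all $L$-formulas $\varphi$ and all finite tuples with $\operatorname{tp}(\bar b_1/A)=\operatorname{tp}(\bar b_2/A)$. It is *weakly regular over $A$* if it is $A$-invariant and for every set $X$ of realizations of $\mathfrak p_{\restriction A}$ and every $a\models\mathfrak p_{\restriction A}$, either $a\models\mathfrak p_{\restriction A\cup X}$ or $\mathfrak p_{\restriction A\cup X}\vdash\mathfrak p_{\restriction A\cup X\cup\{a\}}$. For a linear order $I$, a sequence $(a_i)_{i\in I}$ in $\mathfrak C$ is a *Morley sequence in $\mathfrak p$ over $A$*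 if $a_i\models\mathfrak p_{\restriction A\cup\{a_j:j<i\}}$ for all $i\in I$. $\mathfrak p$ is *$A$-asymmetric* if it is $A$-invariant and $\operatorname{tp}(a,b/A)\ne\operatorname{tp}(b,a/A)$ for some Morley sequence $(a,b)$. A *witness* of the asymmetry is an $A$-definable partial order $\le$ on $\mathfrak C$ for which every Morley sequence in $\mathfrak p$ over $A$ is strictly increasing. $\mathfrak p$ is *convex over $A$* if, for some witness $\le$, the locus $\mathfrak p_{\restriction A}(\mathfrak C)$ is a $\le$-convex subset of $\mathfrak C$. For $a,b\models\mathfrak p_{\restriction A}$ write $a\in\mathcal E_{\mathfrak p}(b)$ if neither $(a,b)$ nor $(b,a)$ is a Morley sequence in $\mathfrak p$ over $A$; $\mathfrak p$ is *simple over $A$* if for some formula $\sigma(x,y)$ over $A$ one has $\sigma(a,b)\Leftrightarrow a\in\mathcal E_{\mathfrak p}(b)$ for all $a,b\models\mathfrak p_{\restriction A}$. A Morley sequence of elements of $X\subseteq\mathfrak C$ is *maximal in $X$* if it is not a proper subsequence of another Morley sequence of elements of $X$. The empty sequence is allowed. Theorem. Suppose that $\mathfrak p$ is weakly regular over $A$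 and $A$-asymmetric. Then for every $X\subseteq\mathfrak C$ there are Morley sequences in $\mathfrak p$ over $A$ that are maximal in $X$, and all of them have the same order type, denoted $\mathrm{Inv}_{\mathfrak p,A}(X)$. Moreover: (i) If $\mathfrak p$ is simple and convex over $A$, then for every elementary substructure $M\preceq\mathfrak C$ containing $A$ such that $\mathrm{Inv}_{\mathfrak p,A}(M)$ has at least two elements, $\mathrm{Inv}_{\mathfrak p,A}(M)$ is a dense linear order (with or without endpoints). (ii) If $L$ and $A$ are countable and $\mathfrak p$ is simple and not convex over $A$, then for every countable linear order $I$ (possibly finite or empty) there is a countable $M\preceq\mathfrak C$ containing $A$ with $\mathrm{Inv}_{\mathfrak p,A}(M)\cong I$. (iii) If $L$ and $A$ are countable and $\mathfrak p$ is not simple over $A$, then for every non-empty countable linear order $I$ there is a countable $M\preceq\mathfrak C$ containing $A$ with $\mathrm{Inv}_{\mathfrak p,A}(M)\cong I$. The same holds for the empty order $I$ if $\mathfrak p_{\restriction A}$ is not isolated (i.e. does not follow from one of its formulas). -/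

import Mathlib

open FirstOrder FirstOrder.Language Cardinal

universe u v w i

namespace AsymType

section Basics

variable {L : FirstOrder.Language.{u, v}} {C : Type w} [L.Structure C]

/-- `tp A a` is the complete type of the tuple `a` over the parameter set `A`: all formulas with
parameters in `A` that hold at `a`. -/
def tp (L : FirstOrder.Language.{u, v}) {C : Type w} [L.Structure C] (A : Set C) {α : Type*} (a : α → C) :
    Set (L[[A]].Formula α) :=
  {φ | φ.Realize a}

/-- `C` is `κ`-saturated: a set of formulas in one variable, with parameters in a set of cardinality
less than `κ`, has a common solution in `C` as soon as each of its finite subsets has one. -/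
def IsSaturated (L : FirstOrder.Language.{u, v}) (C : Type w) [L.Structure C] (κ : Cardinal.{w}) : Prop :=
  ∀ B : Set C, #B < κ → ∀ Γ : Set (L[[B]].Formula (Fin 1)),
    (∀ Γ₀ : Finset (L[[B]].Formula (Fin 1)), (Γ₀ : Set (L[[B]].Formula (Fin 1))) ⊆ Γ →
      ∃ c : C, ∀ φ ∈ Γ₀, φ.Realize fun _ => c) →
    ∃ c : C, ∀ φ ∈ Γ, φ.Realize fun _ => c

/-- A global type: a complete type in one variable over (the elementary diagram of) `C`. -/
abbrev GlobalType (L : FirstOrder.Language.{u, v}) (C : Type w) [L.Structure C] :=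
  (L.elementaryDiagram C).CompleteType (Fin 1)

/-- The formula `φ(b, x)` with parameters in `C` obtained from the `L`-formula `φ(y, x)` by putting
the tuple `b` for the variables `y`. -/
def inst {n : ℕ} (φ : L.Formula (Fin n ⊕ Fin 1)) (b : Fin n → C) : L[[C]].Formula (Fin 1) :=
  BoundedFormula.constantsVarsEquiv.symm (φ.relabel (Sum.map b id))

namespace GlobalType

variable (p : GlobalType L C)

/-- The formula `φ(x)`, with parameters in `C`, belongs to the global type `p(x)`. -/
def Has (φ : L[[C]].Formula (Fin 1)) : Prop :=
  Formula.equivSentence φ ∈ p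

/-- The restriction of `p` to `B`: the formulas with parameters in `B` that belong to `p`. -/
def restrict (B : Set C) : Set (L[[B]].Formula (Fin 1)) :=
  {φ | p.Has ((L.lhomWithConstantsMap (Subtype.val : B → C)).onFormula φ)}

/-- `a` realizes the restriction of `p` to `B`. -/
def Realizes (B : Set C) (a : C) : Prop :=
  ∀ φ ∈ p.restrict B, φ.Realize fun _ => a

/-- The restriction of `p` to `B` implies its restriction to `B'`: each formula of the latter follows
from finitely many formulas of the former. -/
def RestrictImplies (B B' : Set C) : Prop :=
  ∀ φ ∈ p.restrict B', ∃ Γ₀ : Finset (L[[B]].Formula (Fin 1)),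
    (Γ₀ : Set (L[[B]].Formula (Fin 1))) ⊆ p.restrict B ∧
    ∀ c : C, (∀ ψ ∈ Γ₀, ψ.Realize fun _ => c) → φ.Realize fun _ => c

/-- `p` is `A`-invariant, that is, `p` does not split over `A`. -/
def IsInvariant (A : Set C) : Prop :=
  ∀ (n : ℕ) (φ : L.Formula (Fin n ⊕ Fin 1)) (b₁ b₂ : Fin n → C),
    tp L A b₁ = tp L A b₂ → (p.Has (inst φ b₁) ↔ p.Has (inst φ b₂))

/-- `p` is weakly regular over `A`. -/
def IsWeaklyRegular (A : Set C) : Prop :=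
  p.IsInvariant A ∧
  ∀ X : Set C, (∀ x ∈ X, p.Realizes A x) → ∀ a : C, p.Realizes A a →
    p.Realizes (A ∪ X) a ∨ p.RestrictImplies (A ∪ X) (insert a (A ∪ X))

/-- `(a i)`, indexed by the linear order `I`, is a Morley sequence in `p` over `A`. -/
def IsMorley (A : Set C) {I : Type*} [LinearOrder I] (a : I → C) : Prop :=
  ∀ i, p.Realizes (A ∪ a '' Set.Iio i) (a i)

/-- `p` is `A`-asymmetric. -/
def IsAsymmetric (A : Set C) : Prop :=
  p.IsInvariant A ∧
  ∃ a b : C, p.IsMorley A ![a, b] ∧ tp L A ![a, b] ≠ tp L A ![b, a]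

/-- The relation `r` (read as `≤`) witnesses the `A`-asymmetry of `p`: it is an `A`-definable partial
order on `C` for which every Morley sequence in `p` over `A` is strictly increasing. -/
def IsWitness (A : Set C) (r : C → C → Prop) : Prop :=
  IsPartialOrder C r ∧ A.Definable₂ L {x : C × C | r x.1 x.2} ∧
  ∀ (I : Type w) [LinearOrder I] (a : I → C), p.IsMorley A a →
    ∀ i j, i < j → r (a i) (a j) ∧ a i ≠ a j

/-- `p` is convex over `A`: for some witnessing order, the locus in `C` of the restriction of `p`
to `A` is a convex subset of `C`. -/
def IsConvex (A : Set C) : Prop :=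
  ∃ r : C → C → Prop, p.IsWitness A r ∧
    ∀ a b c : C, p.Realizes A a → p.Realizes A c → r a b → r b c → p.Realizes A b

/-- `a ∈ 𝓔(b)`: both realize the restriction of `p` to `A`, and `{a, b}` cannot be ordered into a
Morley sequence in `p` over `A`. -/
def MemE (A : Set C) (a b : C) : Prop :=
  p.Realizes A a ∧ p.Realizes A b ∧
    ¬ p.Realizes (insert b A) a ∧ ¬ p.Realizes (insert a A) b

/-- `p` is simple over `A`: the relation `a ∈ 𝓔(b)` is relatively definable over `A` on the locus of
the restriction of `p` to `A`. -/
def IsSimple (A : Set C) : Prop :=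
  ∃ σ : L[[A]].Formula (Fin 2), ∀ a b : C, p.Realizes A a → p.Realizes A b →
    (σ.Realize ![a, b] ↔ p.MemE A a b)

/-- The restriction of `p` to `A` is isolated: it follows from one of its formulas. -/
def IsIsolatedOver (A : Set C) : Prop :=
  ∃ ψ ∈ p.restrict A, ∀ c : C, (ψ.Realize fun _ => c) → p.Realizes A c

/-- `(a i)` is a maximal Morley sequence in `p` over `A` among those consisting of elements of `X`:
it is not a proper subsequence of another one. -/
def IsMaximalMorley (A X : Set C) {I : Type i} [LinearOrder I] (a : I → C) : Prop :=
  p.IsMorley A a ∧ (∀ i, a i ∈ X) ∧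
  ∀ (J : Type w) [LinearOrder J] (b : J → C), p.IsMorley A b → (∀ j, b j ∈ X) →
    ∀ e : I ↪o J, (∀ i, b (e i) = a i) → Function.Surjective e

/-- `Inv_{p,A}(X) ≅ I`: maximal Morley sequences in `p` over `A` consisting of elements of `X`
have a well-defined order type, and it is that of `I`. -/
def InvIs (A X : Set C) (I : Type i) [LinearOrder I] : Prop :=
  (∃ a : I → C, p.IsMaximalMorley A X a) ∧
  ∀ (J : Type w) [LinearOrder J] (b : J → C), p.IsMaximalMorley A X b → Nonempty (I ≃o J)

end GlobalType

end Basics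

end AsymType

/-!
The proof works with definable sets instead of formulas; a global type is then an ultrafilter of
definable sets (`GlobalType.Large`).

Let `P` be the locus of the restriction of `p` to `A`, and for `x, y ∈ P` let `x < y` mean that `(x, y)`
is a Morley sequence (`GlobalType.Lt`). Asymmetry makes this relation asymmetric, since all Morley
pairs have the same type over `A`, and weak regularity makes incomparability transitive
(`IsWeaklyRegular.lt_or_lt`). So `P` modulo `𝓔` is a linear order, and by the finite character of types
an element realizes `p` over `A ∪ Y`, for `Y ⊆ P`, exactly when it is above all elements of `Y`
(`IsWeaklyRegular.realizes_union_iff`). Hence Morley sequences are the strictly increasing ones, the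
maximal ones in `X` are the transversals of the classes that meet `X`, and the order type of these
classes is the invariant of `X`. Finite increasing sequences of a given length all have the same
type, and with saturation it follows that the order of classes is dense. Every countable order `I`
therefore indexes a Morley sequence `a`.

If `p` is simple and convex, then the statement that there is an element of `P` strictly between two
given elements is witnessed by a definable set, which meets every elementary substructure containing
the parameters.

For the realization of `I` it is enough to omit, in a countable model containing `A` and `a`, the
elements of `P` that are in the class of no entry of `a`. These form a type-definable set. The
omitting types theorem (`NonIsolated.exists_elementarySubstructure`) does this unless some nonempty
set `D`, definable over `A` and finitely many entries of `a`, consists of such elements. By the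
uniqueness of types of increasing sequences such a `D` includes a whole interval `(u, w)` of `P`, and
compactness gives an `A`-definable relation `χ`, true of all Morley pairs, such that `χ u z` and `χ z w`
imply `z ∈ D` (`exists_interval_subset`). On the one hand, as `D ⊆ P`, the relation `χ` leads to a
definable order for which `P` is convex (`isConvex_of_isMorleyRel`). On the other hand, if there are
entries at all, then `u` or `w` can be taken among them, so that `χ` is false on each class, and `p` is
simple (`isSimple_of_isMorleyRel`).
-/

/-! ### Definable sets and types of tuples -/

namespace AsymType

section Definability

variable {L : FirstOrder.Language.{u, v}} {C : Type w} [L.Structure C] {B : Set C}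

/-- Entries of a definable relation may be replaced by constants, which become parameters. -/
theorem definable_specialize {ι α : Type*} {R : Set (ι ⊕ α → C)} (hR : B.Definable L R)
    (a : ι → C) : (B ∪ Set.range a).Definable L {x : α → C | Sum.elim a x ∈ R} := by
  rw [Set.definable_iff_exists_formula_sum] at hR ⊢
  obtain ⟨φ, rfl⟩ := hR
  refine ⟨φ.relabel (Sum.elim (fun b : B => Sum.inl ⟨b, Or.inl b.2⟩)
    (Sum.elim (fun j => Sum.inl ⟨a j, Or.inr ⟨j, rfl⟩⟩) Sum.inr)), ?_⟩
  ext x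
  simp only [Set.mem_ofPred_eq, Formula.realize_relabel]
  refine iff_of_eq (congrArg _ ?_)
  funext k
  rcases k with b | j | k <;> rfl

theorem definable_specialize_of_mem {ι α : Type*} {R : Set (ι ⊕ α → C)} (hR : B.Definable L R)
    {a : ι → C} (ha : ∀ j, a j ∈ B) : B.Definable L {x : α → C | Sum.elim a x ∈ R} := by
  have h := definable_specialize hR a
  rwa [Set.union_eq_self_of_subset_right (Set.range_subset_iff.2 ha)] at h

/-- A set definable over `B` and the entries of `a` is obtained from a `B`-definable relation by
putting `a` for some of the variables. -/
theorem exists_definable_of_union_range {ι α : Type*} {a : ι → C} {s : Set (α → C)}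
    (hs : (B ∪ Set.range a).Definable L s) :
    ∃ R : Set (ι ⊕ α → C), B.Definable L R ∧ s = {x | Sum.elim a x ∈ R} := by
  classical
  rw [Set.definable_iff_exists_formula_sum] at hs
  obtain ⟨φ, rfl⟩ := hs
  let g : ↥(B ∪ Set.range a) → B ⊕ ι := fun b =>
    if h : (b : C) ∈ B then Sum.inl ⟨b, h⟩ else Sum.inr (b.2.resolve_left h).choose
  have hg : ∀ b, Sum.elim (Subtype.val : B → C) a (g b) = b := by
    intro b
    by_cases h : (b : C) ∈ B
    · simp [g, h]
    · simpa [g, h] using (b.2.resolve_left h).choose_spec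
  refine ⟨{x | (φ.relabel (Sum.elim (fun b => Sum.elim Sum.inl (fun j => Sum.inr (Sum.inl j)) (g b))
    (fun k => Sum.inr (Sum.inr k))) : L.Formula (B ⊕ (ι ⊕ α))).Realize
      (Sum.elim (Subtype.val : B → C) x)},
    Set.definable_iff_exists_formula_sum.2 ⟨_, rfl⟩, ?_⟩
  ext x
  simp only [Set.mem_ofPred_eq, Formula.realize_relabel]
  refine iff_of_eq (congrArg _ ?_)
  funext k
  rcases k with b | k
  · rw [Sum.elim_inl, ← hg b]
    simp only [Function.comp, Sum.elim_inl]
    rcases g b with b' | j <;> rfl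
  · rfl

/-- The fibre over the tuple `a` of a relation between tuples and elements. -/
def fiber {ι : Type*} (R : Set (ι ⊕ Fin 1 → C)) (a : ι → C) : Set C :=
  {c | Sum.elim a (fun _ => c) ∈ R}

theorem mem_fiber {ι : Type*} {R : Set (ι ⊕ Fin 1 → C)} {a : ι → C} {c : C} :
    c ∈ fiber R a ↔ Sum.elim a (fun _ => c) ∈ R := Iff.rfl

theorem fun_fin_one {C : Type*} (x : Fin 1 → C) : (fun _ => x 0) = x := by
  funext k; rw [Subsingleton.elim k 0]

theorem definable_fiber {ι : Type*} {R : Set (ι ⊕ Fin 1 → C)} (hR : B.Definable L R) (a : ι → C) :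
    (B ∪ Set.range a).Definable₁ L (fiber R a) := by
  have h := definable_specialize hR a
  rw [Set.Definable₁]
  convert h using 1
  ext x
  simp only [fiber, Set.mem_ofPred_eq, fun_fin_one]

theorem exists_fiber_of_definable {ι : Type*} {a : ι → C} {D : Set C}
    (hD : (B ∪ Set.range a).Definable₁ L D) :
    ∃ R : Set (ι ⊕ Fin 1 → C), B.Definable L R ∧ D = fiber R a := by
  obtain ⟨R, hR, h⟩ := exists_definable_of_union_range hD
  refine ⟨R, hR, ?_⟩
  ext c
  exact Set.ext_iff.1 h (fun _ => c)

theorem definable_exists_fiber {ι : Type*} {R : Set (ι ⊕ Fin 1 → C)} (hR : B.Definable L R) :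
    B.Definable L {a : ι → C | (fiber R a).Nonempty} := by
  refine (congrArg _ ?_).mp hR.exists_of_finite
  ext a
  constructor
  · rintro ⟨x, hx⟩
    exact ⟨x 0, by rwa [mem_fiber, fun_fin_one]⟩
  · rintro ⟨c, hc⟩
    exact ⟨_, hc⟩

theorem definable_forall_fiber {ι : Type*} {R : Set (ι ⊕ Fin 1 → C)} (hR : B.Definable L R) :
    B.Definable L {a : ι → C | ∀ c, c ∈ fiber R a} := by
  refine (congrArg _ ?_).mp hR.forall_of_finite
  ext a
  constructor
  · intro h c
    exact h fun _ => c
  · intro h x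
    have := h (x 0)
    rwa [mem_fiber, fun_fin_one] at this

theorem definable_of_definable₂ {ι : Type*} {χ : C → C → Prop}
    (hχ : B.Definable L {v : Fin 2 → C | χ (v 0) (v 1)}) (i j : ι) :
    B.Definable L {v : ι → C | χ (v i) (v j)} :=
  hχ.preimage_comp ![i, j]

theorem definable_of_definable₁ {ι : Type*} {D : Set C} (hD : B.Definable₁ L D) (i : ι) :
    B.Definable L {v : ι → C | v i ∈ D} :=
  hD.preimage_comp ![i]

theorem definable_eq {ι : Type*} (i j : ι) : B.Definable L {v : ι → C | v i = v j} :=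
  ⟨(Term.var i).equal (Term.var j), by ext; simp⟩

theorem definable_imp {ι : Type*} {P Q : (ι → C) → Prop} (hP : B.Definable L {v | P v})
    (hQ : B.Definable L {v | Q v}) : B.Definable L {v | P v → Q v} :=
  hP.himp hQ

/-- Two tuples have the same type over `B` when they belong to the same `B`-definable sets. -/
def SameTp (L : FirstOrder.Language.{u, v}) [L.Structure C] (B : Set C) {ι : Type*}
    (a a' : ι → C) : Prop :=
  ∀ R : Set (ι → C), B.Definable L R → a ∈ R → a' ∈ R

theorem SameTp.iff {ι : Type*} {a a' : ι → C} (h : SameTp L B a a') {R : Set (ι → C)}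
    (hR : B.Definable L R) : a ∈ R ↔ a' ∈ R :=
  ⟨h R hR, fun h' => by_contra fun h'' => h Rᶜ hR.compl h'' h'⟩

theorem SameTp.symm {ι : Type*} {a a' : ι → C} (h : SameTp L B a a') : SameTp L B a' a :=
  fun _ hR h' => (h.iff hR).2 h'

theorem SameTp.comp {ι ι' : Type*} {a a' : ι → C} (h : SameTp L B a a') (f : ι' → ι) :
    SameTp L B (a ∘ f) (a' ∘ f) :=
  fun _ hR h' => h _ (hR.preimage_comp f) h'

theorem SameTp.tp_eq {ι : Type*} {a a' : ι → C} (h : SameTp L B a a') : tp L B a = tp L B a' :=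
  Set.ext fun φ => h.iff ⟨φ, rfl⟩

/-- Parameters from `B` may be added to tuples of the same type over `B`. -/
theorem SameTp.sumElim {ι κ : Type*} {a a' : ι → C} (h : SameTp L B a a') {b : κ → C}
    (hb : ∀ k, b k ∈ B) : SameTp L B (Sum.elim b a) (Sum.elim b a') :=
  fun _ hR h' => h _ (definable_specialize_of_mem hR hb) h'

theorem countable_definable {α : Type*} [Countable α] (hL : L.card ≤ ℵ₀) (hB : B.Countable) :
    {R : Set (α → C) | B.Definable L R}.Countable := by
  have : Countable L.Symbols := Cardinal.mk_le_aleph0_iff.1 hL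
  have : Countable B := hB.to_subtype
  refine (Set.countable_range fun φ : L[[B]].Formula α => Set.ofPred φ.Realize).mono ?_
  rintro R ⟨φ, rfl⟩
  exact ⟨φ, rfl⟩

/-- Saturation, for downward directed families of definable sets. -/
theorem IsSaturated.iInter_nonempty {κ : Cardinal.{w}} (hC : IsSaturated L C κ) (hB : #B < κ)
    {I : Type*} [Nonempty I] {D : I → Set C} (hD : ∀ i, B.Definable₁ L (D i))
    (hdir : Directed (· ⊇ ·) D) (hne : ∀ i, (D i).Nonempty) : (⋂ i, D i).Nonempty := by
  classical
  choose φ hφ using hD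
  have hr : ∀ i c, (φ i).Realize (fun _ => c) ↔ c ∈ D i := fun i c =>
    (Set.ext_iff.1 (hφ i) fun _ => c).symm
  obtain ⟨c, hc⟩ := hC B hB (Set.range φ) (by
    intro Γ₀ hΓ₀
    choose! k hk using hΓ₀
    obtain ⟨j, hj⟩ := hdir.finset_le (Γ₀.image k)
    obtain ⟨c, hc⟩ := hne j
    refine ⟨c, fun ψ hψ => ?_⟩
    rw [← hk hψ, hr]
    exact hj _ (Finset.mem_image_of_mem k hψ) hc)
  exact ⟨c, Set.mem_iInter.2 fun i => (hr i c).1 (hc _ ⟨i, rfl⟩)⟩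

end Definability

/-! ### Global types as ultrafilters of definable sets -/

namespace GlobalType

section Large

variable {L : FirstOrder.Language.{u, v}} {C : Type w} [L.Structure C] (p : GlobalType L C)

/-- The definable subsets of `C` that belong to the global type `p`. They form an ultrafilter on the
Boolean algebra of definable subsets of `C`. -/
def Large (D : Set C) : Prop :=
  ∃ φ : L[[C]].Formula (Fin 1), p.Has φ ∧ D = {c | φ.Realize fun _ => c}

variable {p}

/-- A global type contains the formulas that are valid in `C`. -/
theorem has_of_forall_realize {φ : L[[C]].Formula (Fin 1)} (h : ∀ c : C, φ.Realize fun _ => c) :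
    p.Has φ := by
  refine Theory.CompleteType.mem_of_models p ?_
  rw [← Theory.models_formula_iff_onTheory_models_equivSentence, Theory.models_formula_iff]
  intro M x
  have hall : (φ.relabel (Sum.inr : Fin 1 → Empty ⊕ Fin 1)).iAlls (Fin 1) ∈
      L.elementaryDiagram C := by
    rw [elementaryDiagram, mem_completeTheory, Sentence.Realize, Formula.realize_iAlls]
    intro y
    rw [Formula.realize_relabel, Sum.elim_comp_inr, ← fun_fin_one y]
    exact h _
  have := M.is_model.realize_of_mem _ hall
  rw [Sentence.Realize, Formula.realize_iAlls] at this
  have := this x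
  rwa [Formula.realize_relabel, Sum.elim_comp_inr] at this

theorem Has.mp {φ ψ : L[[C]].Formula (Fin 1)} (h : p.Has (φ.imp ψ)) (hφ : p.Has φ) : p.Has ψ := by
  refine (p.isMaximal.mem_iff_models _).2 ?_
  rw [Theory.models_sentence_iff]
  intro M
  have h1 := M.is_model.realize_of_mem _ h
  have h2 := M.is_model.realize_of_mem _ hφ
  let _ : L[[C]].Structure M := (L[[C]].lhomWithConstants (Fin 1)).reduct M
  have _ : (L[[C]].lhomWithConstants (Fin 1)).IsExpansionOn M := LHom.isExpansionOn_reduct _ _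
  rw [Formula.realize_equivSentence] at h1 h2 ⊢
  exact h1 h2

theorem has_not_iff {φ : L[[C]].Formula (Fin 1)} : p.Has φ.not ↔ ¬ p.Has φ := by
  constructor
  · intro h h'
    obtain ⟨M⟩ := p.isMaximal.1
    have h1 := M.is_model.realize_of_mem _ h
    have h2 := M.is_model.realize_of_mem _ h'
    let _ : L[[C]].Structure M := (L[[C]].lhomWithConstants (Fin 1)).reduct M
    have _ : (L[[C]].lhomWithConstants (Fin 1)).IsExpansionOn M := LHom.isExpansionOn_reduct _ _
    rw [Formula.realize_equivSentence] at h1 h2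
    exact h1 h2
  · intro h
    by_contra h'
    have hn := (p.not_mem_iff (Formula.equivSentence φ)).2 h
    have hn' := (p.not_mem_iff (Formula.equivSentence φ.not)).2 h'
    obtain ⟨M⟩ := p.isMaximal.1
    have h1 := M.is_model.realize_of_mem _ hn
    have h2 := M.is_model.realize_of_mem _ hn'
    let _ : L[[C]].Structure M := (L[[C]].lhomWithConstants (Fin 1)).reduct M
    have _ : (L[[C]].lhomWithConstants (Fin 1)).IsExpansionOn M := LHom.isExpansionOn_reduct _ _
    rw [Sentence.realize_not, Formula.realize_equivSentence] at h1 h2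
    exact h2 h1

/-- Membership in a global type depends only on the set that a formula defines. -/
theorem has_iff_large {φ : L[[C]].Formula (Fin 1)} :
    p.Has φ ↔ p.Large {c | φ.Realize fun _ => c} := by
  refine ⟨fun h => ⟨φ, h, rfl⟩, ?_⟩
  rintro ⟨ψ, hψ, h⟩
  refine Has.mp (has_of_forall_realize fun c => ?_) hψ
  exact fun hc => (Set.ext_iff.1 h c).2 hc

theorem exists_formula_of_definable₁ {B D : Set C} (hD : B.Definable₁ L D) :
    ∃ φ : L[[B]].Formula (Fin 1), D = {c | φ.Realize fun _ => c} := by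
  obtain ⟨φ, hφ⟩ := hD
  exact ⟨φ, Set.ext fun c => Set.ext_iff.1 hφ fun _ => c⟩

theorem definable₁_realize {B : Set C} (φ : L[[B]].Formula (Fin 1)) :
    B.Definable₁ L {c | φ.Realize fun _ => c} :=
  ⟨φ, by ext x; simp only [Set.mem_ofPred_eq, fun_fin_one]⟩

theorem isExpansionOn_lhomWithConstantsMap_val (L : FirstOrder.Language.{u, v}) [L.Structure C]
    (B : Set C) : (L.lhomWithConstantsMap (Subtype.val : B → C)).IsExpansionOn C :=
  have : (LHom.constantsOnMap (Subtype.val : B → C)).IsExpansionOn C :=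
    constantsOnMap_isExpansionOn rfl
  LHom.sumMap_isExpansionOn _ _ _

theorem realize_onFormula_val {B : Set C} (φ : L[[B]].Formula (Fin 1)) (x : Fin 1 → C) :
    ((L.lhomWithConstantsMap (Subtype.val : B → C)).onFormula φ).Realize x ↔ φ.Realize x :=
  have := isExpansionOn_lhomWithConstantsMap_val L B
  LHom.realize_onFormula _ _

theorem mem_restrict_iff {B : Set C} {φ : L[[B]].Formula (Fin 1)} :
    φ ∈ p.restrict B ↔ p.Large {c | φ.Realize fun _ => c} := by
  rw [restrict, Set.mem_ofPred_eq, has_iff_large]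
  simp only [realize_onFormula_val]

theorem exists_formula_of_definable₁_univ {B D : Set C} (hD : B.Definable₁ L D) :
    ∃ φ : L[[C]].Formula (Fin 1), D = {c | φ.Realize fun _ => c} := by
  obtain ⟨φ, hφ⟩ := exists_formula_of_definable₁ hD
  refine ⟨(L.lhomWithConstantsMap (Subtype.val : B → C)).onFormula φ, ?_⟩
  simp only [realize_onFormula_val, hφ]

theorem Large.mono {B D D' : Set C} (h : p.Large D) (hD' : B.Definable₁ L D') (hle : D ⊆ D') :
    p.Large D' := by
  obtain ⟨φ, hφ, rfl⟩ := h
  obtain ⟨ψ, rfl⟩ := exists_formula_of_definable₁_univ hD'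
  exact ⟨ψ, Has.mp (has_of_forall_realize fun c => Formula.realize_imp.2 fun hc => @hle c hc) hφ, rfl⟩

theorem large_compl_iff {B D : Set C} (hD : B.Definable₁ L D) : p.Large Dᶜ ↔ ¬ p.Large D := by
  obtain ⟨φ, rfl⟩ := exists_formula_of_definable₁_univ hD
  rw [← has_iff_large, ← has_not_iff, has_iff_large]
  rfl

theorem Large.inter {D D' : Set C} (h : p.Large D) (h' : p.Large D') : p.Large (D ∩ D') := by
  obtain ⟨φ, hφ, rfl⟩ := h
  obtain ⟨ψ, hψ, rfl⟩ := h'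
  refine ⟨φ ⊓ ψ, ?_, ?_⟩
  · refine Has.mp (Has.mp (has_of_forall_realize fun c => ?_) hφ) hψ
    intro h1 h2
    exact Formula.realize_inf.2 ⟨h1, h2⟩
  · ext c
    simp [Formula.realize_inf]

theorem large_univ : p.Large (Set.univ : Set C) :=
  ⟨⊤, has_of_forall_realize fun _ => Formula.realize_top.2 trivial, by simp⟩

theorem Large.nonempty {D : Set C} (h : p.Large D) : D.Nonempty := by
  by_contra hD
  rw [Set.not_nonempty_iff_eq_empty] at hD
  subst hD
  have hd : (∅ : Set C).Definable₁ L (∅ : Set C) := Set.definable_empty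
  refine (large_compl_iff (p := p) hd).1 ?_ h
  rw [Set.compl_empty]
  exact large_univ

theorem realizes_iff {B : Set C} {a : C} :
    p.Realizes B a ↔ ∀ D : Set C, B.Definable₁ L D → p.Large D → a ∈ D := by
  constructor
  · intro h D hD hl
    obtain ⟨φ, rfl⟩ := exists_formula_of_definable₁ hD
    exact h φ (mem_restrict_iff.2 hl)
  · intro h φ hφ
    exact h _ (definable₁_realize φ) (mem_restrict_iff.1 hφ)

theorem Realizes.mem_iff {B D : Set C} {a : C} (h : p.Realizes B a) (hD : B.Definable₁ L D) :
    a ∈ D ↔ p.Large D := by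
  refine ⟨fun ha => by_contra fun hl => ?_, realizes_iff.1 h D hD⟩
  exact realizes_iff.1 h Dᶜ (Set.Definable.compl hD) ((large_compl_iff hD).2 hl) ha

theorem Realizes.anti {B B' : Set C} {a : C} (h : p.Realizes B a) (hB : B' ⊆ B) :
    p.Realizes B' a :=
  realizes_iff.2 fun D hD => realizes_iff.1 h D (Set.Definable.mono hD hB)

theorem RestrictImplies.realizes {B B' : Set C} (h : p.RestrictImplies B B') {a : C}
    (ha : p.Realizes B a) : p.Realizes B' a := by
  intro φ hφ
  obtain ⟨Γ₀, h1, h2⟩ := h φ hφ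
  exact h2 a fun ψ hψ => ha ψ (h1 hψ)

/-- Realizing a global type is a property of finite character. -/
theorem realizes_union_of_finset {B Y : Set C} {a : C}
    (h : ∀ Y₀ : Finset C, (Y₀ : Set C) ⊆ Y → p.Realizes (B ∪ Y₀) a) : p.Realizes (B ∪ Y) a := by
  classical
  refine realizes_iff.2 fun D hD => ?_
  obtain ⟨F, hF, hd⟩ := Set.definable_iff_finitely_definable.1 hD
  refine realizes_iff.1 (h (F.filter (· ∈ Y)) fun x hx => (Finset.mem_filter.1 hx).2) D
    (Set.Definable.mono hd fun x hx => ?_)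
  by_cases hY : x ∈ Y
  · exact Or.inr (Finset.mem_coe.2 (Finset.mem_filter.2 ⟨hx, hY⟩))
  · exact Or.inl ((hF hx).resolve_right hY)

/-- The restriction of a global type to a small set is realized. -/
theorem exists_realizes {κ : Cardinal.{w}} (hC : IsSaturated L C κ) {B : Set C} (hB : #B < κ) :
    ∃ c, p.Realizes B c := by
  let I := {D : Set C // B.Definable₁ L D ∧ p.Large D}
  have hne : Nonempty I := ⟨⟨Set.univ, Set.definable_univ, large_univ⟩⟩
  obtain ⟨c, hc⟩ := hC.iInter_nonempty hB (D := fun D : I => D.1) (fun D => D.2.1)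
    (fun D D' => ⟨⟨D.1 ∩ D'.1, Set.Definable.inter D.2.1 D'.2.1, D.2.2.inter D'.2.2⟩,
      Set.inter_subset_left, Set.inter_subset_right⟩) (fun D => D.2.2.nonempty)
  exact ⟨c, realizes_iff.2 fun D hD hl => Set.mem_iInter.1 hc ⟨D, hD, hl⟩⟩

theorem has_inst_iff {n : ℕ} {φ : L.Formula (Fin n ⊕ Fin 1)} {b : Fin n → C} :
    p.Has (inst φ b) ↔ p.Large (fiber (Set.ofPred φ.Realize) b) := by
  rw [has_iff_large]
  refine iff_of_eq (congrArg _ (Set.ext fun c => ?_))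
  simp only [fiber, Set.mem_ofPred_eq]
  rw [inst, Formula.Realize, ← BoundedFormula.realize_constantsVarsEquiv, Equiv.apply_symm_apply]
  refine Formula.realize_relabel.trans (iff_of_eq (congrArg _ ?_))
  funext k
  rcases k with k | k <;> rfl

/-- An invariant global type does not distinguish the fibres of a definable relation over two tuples
of the same type. -/
theorem IsInvariant.large_fiber_iff {A : Set C} (h : p.IsInvariant A) {ι : Type*} [Finite ι]
    {a a' : ι → C} (ha : SameTp L A a a') {R : Set (ι ⊕ Fin 1 → C)} (hR : A.Definable L R) :
    p.Large (fiber R a) ↔ p.Large (fiber R a') := by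
  obtain ⟨F, hF, hd⟩ := Set.definable_iff_finitely_definable.1 hR
  obtain ⟨φ, rfl⟩ := Set.definable_iff_exists_formula_sum.1 hd
  obtain ⟨n, ⟨e⟩⟩ := Finite.exists_equiv_fin (((F : Set C) : Type w) ⊕ ι)
  have key : ∀ b : ι → C, fiber {x : ι ⊕ Fin 1 → C | φ.Realize (Sum.elim (↑) x)} b =
      fiber (Set.ofPred (φ.relabel (Sum.elim (fun f => Sum.inl (e (Sum.inl f)))
        (Sum.elim (fun j => Sum.inl (e (Sum.inr j))) Sum.inr))).Realize)
        (Sum.elim (fun f : ((F : Set C) : Type w) => (f : C)) b ∘ e.symm) := by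
    intro b
    ext c
    simp only [fiber, Set.mem_ofPred_eq, Formula.realize_relabel]
    refine iff_of_eq (congrArg _ ?_)
    funext k
    rcases k with f | j | k <;> simp
  rw [key, key, ← has_inst_iff, ← has_inst_iff]
  exact h n _ _ _ ((ha.sumElim fun f => hF f.2).comp e.symm).tp_eq

/-- Realizations of an invariant type over two tuples of the same type extend these tuples in the
same way. -/
theorem IsInvariant.sameTp_sumElim {A : Set C} (h : p.IsInvariant A) {ι : Type*} [Finite ι]
    {a a' : ι → C} (ha : SameTp L A a a') {c c' : C} (hc : p.Realizes (A ∪ Set.range a) c)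
    (hc' : p.Realizes (A ∪ Set.range a') c') :
    SameTp L A (Sum.elim a fun _ : Fin 1 => c) (Sum.elim a' fun _ : Fin 1 => c') := by
  intro R hR hm
  rw [← mem_fiber, hc.mem_iff (definable_fiber hR a)] at hm
  rw [← mem_fiber, hc'.mem_iff (definable_fiber hR a')]
  exact (h.large_fiber_iff ha hR).1 hm

end Large
end GlobalType

/-- Saturation gives the back-and-forth property for finite tuples. -/
theorem IsSaturated.exists_sameTp {L : FirstOrder.Language.{u, v}} {C : Type w} [L.Structure C]
    {κ : Cardinal.{w}} (hκ : ℵ₀ ≤ κ) (hC : IsSaturated L C κ) {A : Set C} (hA : #A < κ)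
    {ι : Type*} [Finite ι] {a a' : ι → C} (ha : SameTp L A a a') (c : C) :
    ∃ c', SameTp L A (Sum.elim a fun _ : Fin 1 => c) (Sum.elim a' fun _ : Fin 1 => c') := by
  let I := {R : Set (ι ⊕ Fin 1 → C) // A.Definable L R ∧ c ∈ fiber R a}
  have hne : Nonempty I := ⟨⟨Set.univ, Set.definable_univ, trivial⟩⟩
  have hB : #(A ∪ Set.range a' : Set C) < κ :=
    (Cardinal.mk_union_le _ _).trans_lt (Cardinal.add_lt_of_lt hκ hA
      ((Set.finite_range a').lt_aleph0.trans_le hκ))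
  obtain ⟨c', hc'⟩ := hC.iInter_nonempty hB (D := fun R : I => fiber R.1 a')
    (fun R => definable_fiber R.2.1 a')
    (fun R S => ⟨⟨R.1 ∩ S.1, R.2.1.inter S.2.1, R.2.2, S.2.2⟩, fun x hx => hx.1, fun x hx => hx.2⟩)
    (fun R => ha _ (definable_exists_fiber R.2.1) ⟨c, R.2.2⟩)
  exact ⟨c', fun R hR hm => Set.mem_iInter.1 hc' ⟨R, hR, hm⟩⟩

end AsymType

/-! ### The Morley order -/

namespace AsymType
namespace GlobalType

section Order

variable {L : FirstOrder.Language.{u, v}} {C : Type w} [L.Structure C] {p : GlobalType L C}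
  {A : Set C}

variable (p A) in
/-- The Morley order on the locus of `p` restricted to `A`: `(x, y)` is a Morley sequence. -/
def Lt (x y : C) : Prop :=
  p.Realizes A x ∧ p.Realizes A y ∧ p.Realizes (insert x A) y

theorem IsInvariant.sameTp_single (h : p.IsInvariant A) {x x' : C} (hx : p.Realizes A x)
    (hx' : p.Realizes A x') : SameTp L A (fun _ : Fin 1 => x) (fun _ : Fin 1 => x') := by
  have h0 : SameTp L A (Fin.elim0 : Fin 0 → C) Fin.elim0 := fun _ _ h => h
  have he : A ∪ Set.range (Fin.elim0 : Fin 0 → C) = A := by simp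
  exact (h.sameTp_sumElim h0 (he.symm ▸ hx) (he.symm ▸ hx')).comp fun _ => Sum.inr 0

/-- Any two Morley pairs have the same type over `A`. -/
theorem IsInvariant.sameTp_pair (h : p.IsInvariant A) {x y x' y' : C} (hl : p.Lt A x y)
    (hl' : p.Lt A x' y') : SameTp L A ![x, y] ![x', y'] := by
  have hr : ∀ z : C, A ∪ Set.range (fun _ : Fin 1 => z) = insert z A := fun z => by simp
  have key := (h.sameTp_sumElim (h.sameTp_single hl.1 hl'.1) ((hr x).symm ▸ hl.2.2)
    ((hr x').symm ▸ hl'.2.2)).comp ![Sum.inl 0, Sum.inr 0]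
  have hc : ∀ z t : C, (Sum.elim (fun _ : Fin 1 => z) fun _ : Fin 1 => t) ∘ ![Sum.inl 0, Sum.inr 0]
      = ![z, t] := fun z t => by
    funext k; fin_cases k <;> rfl
  rwa [hc, hc] at key

theorem IsAsymmetric.exists_pair (h : p.IsAsymmetric A) :
    ∃ a b, p.Lt A a b ∧ ¬ SameTp L A ![a, b] ![b, a] := by
  obtain ⟨-, a, b, hm, hne⟩ := h
  refine ⟨a, b, ⟨?_, ?_, ?_⟩, fun hs => hne hs.tp_eq⟩
  · exact (hm 0).anti Set.subset_union_left
  · exact (hm 1).anti Set.subset_union_left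
  · refine (hm 1).anti (Set.insert_subset (Or.inr ⟨0, ?_, rfl⟩) Set.subset_union_left)
    simp

theorem IsAsymmetric.lt_asymm (h : p.IsAsymmetric A) {x y : C} (hl : p.Lt A x y) :
    ¬ p.Lt A y x := by
  intro hl'
  obtain ⟨a, b, hab, hn⟩ := h.exists_pair
  have h1 := h.1.sameTp_pair hab hl
  have h2 := (h.1.sameTp_pair hl' hab).comp ![1, 0]
  have hc : ∀ z t : C, ![z, t] ∘ ![1, 0] = ![t, z] := fun z t => by
    funext k; fin_cases k <;> rfl
  rw [hc, hc] at h2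
  exact hn fun R hR hm => h2 R hR (h1 R hR hm)

theorem IsWeaklyRegular.realizes_insert (h : p.IsWeaklyRegular A) {X : Set C}
    (hX : ∀ x ∈ X, p.Realizes A x) {a c : C} (ha : p.Realizes A a) (hna : ¬ p.Realizes (A ∪ X) a)
    (hc : p.Realizes (A ∪ X) c) : p.Realizes (A ∪ insert a X) c := by
  rw [Set.union_insert]
  exact ((h.2 X hX a ha).resolve_left hna).realizes hc

/-- Elements that depend on `X` may be added to `X` without changing what it means to realize `p`
over `A` and `X`. -/
theorem IsWeaklyRegular.realizes_union_finset (h : p.IsWeaklyRegular A) {X : Set C}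
    (hX : ∀ x ∈ X, p.Realizes A x) {c : C} (hc : p.Realizes (A ∪ X) c) (W : Finset C)
    (hW : ∀ y ∈ W, p.Realizes A y ∧ ¬ p.Realizes (A ∪ X) y) :
    p.Realizes (A ∪ (X ∪ W)) c := by
  classical
  induction W using Finset.induction_on with
  | empty => simpa using hc
  | insert y W _ ih =>
    have hW' : ∀ z ∈ W, p.Realizes A z ∧ ¬ p.Realizes (A ∪ X) z := fun z hz =>
      hW z (Finset.mem_insert_of_mem hz)
    have hy := hW y (Finset.mem_insert_self y W)
    rw [Finset.coe_insert, Set.union_insert]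
    refine h.realizes_insert ?_ hy.1 (fun hn => hy.2 (hn.anti ?_)) (ih hW')
    · rintro z (hz | hz)
      · exact hX z hz
      · exact (hW' z hz).1
    · exact Set.union_subset_union_right _ Set.subset_union_left

/-- Incomparability in the Morley order is transitive. -/
theorem IsWeaklyRegular.lt_or_lt (h : p.IsWeaklyRegular A) {x y z : C} (hl : p.Lt A x z)
    (hy : p.Realizes A y) : p.Lt A x y ∨ p.Lt A y z := by
  by_cases hxy : p.Realizes (insert x A) y
  · exact Or.inl ⟨hl.1, hy, hxy⟩
  · right
    have hr : A ∪ {x} = insert x A := Set.union_singleton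
    have := h.realizes_insert (X := {x}) (by rintro _ rfl; exact hl.1) hy (by rwa [hr])
      (by rw [hr]; exact hl.2.2)
    exact ⟨hy, hl.2.1, this.anti (Set.insert_subset (Or.inr (Or.inl rfl)) Set.subset_union_left)⟩

theorem IsWeaklyRegular.lt_trans (h : p.IsWeaklyRegular A) (h' : p.IsAsymmetric A) {x y z : C}
    (hxy : p.Lt A x y) (hyz : p.Lt A y z) : p.Lt A x z :=
  (h.lt_or_lt hxy hyz.2.1).resolve_right (h'.lt_asymm hyz)

/-- An element realizes `p` over `A` and a set of elements of the locus exactly when it lies above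
all of them in the Morley order. -/
theorem IsWeaklyRegular.realizes_union_iff (h : p.IsWeaklyRegular A) (h' : p.IsAsymmetric A)
    {Y : Set C} (hY : ∀ y ∈ Y, p.Realizes A y) {c : C} :
    p.Realizes (A ∪ Y) c ↔ p.Realizes A c ∧ ∀ y ∈ Y, p.Lt A y c := by
  classical
  constructor
  · intro hc
    have hcA := hc.anti Set.subset_union_left
    exact ⟨hcA, fun y hy => ⟨hY y hy, hcA,
      hc.anti (Set.insert_subset (Or.inr hy) Set.subset_union_left)⟩⟩
  · rintro ⟨hcA, hc⟩
    refine realizes_union_of_finset fun Y₀ => ?_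
    induction Y₀ using Finset.induction_on with
    | empty => intro _; simpa using hcA
    | insert y W _ ih =>
      intro hsub
      rw [Finset.coe_insert, Set.insert_subset_iff] at hsub
      have ih := ih hsub.2
      have hWP : ∀ z ∈ W, p.Realizes A z := fun z hz => hY z (hsub.2 hz)
      rw [Finset.coe_insert]
      by_cases hy : p.Realizes (A ∪ W) y
      -- Here `y` lies above `W`, so that `W` depends on `y`.
      · have key := h.realizes_union_finset (X := {y}) (by rintro _ rfl; exact hY _ hsub.1)
          (c := c) (by rw [Set.union_singleton]; exact (hc y hsub.1).2.2) W (fun z hz => by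
            refine ⟨hWP z hz, fun hn => ?_⟩
            rw [Set.union_singleton] at hn
            exact h'.lt_asymm ⟨hY y hsub.1, hWP z hz, hn⟩ ⟨hWP z hz, hY y hsub.1,
              hy.anti (Set.insert_subset (Or.inr hz) Set.subset_union_left)⟩)
        rwa [Set.singleton_union] at key
      · exact h.realizes_insert hWP (hY y hsub.1) hy ih

theorem memE_iff {a b : C} : p.MemE A a b ↔
    p.Realizes A a ∧ p.Realizes A b ∧ ¬ p.Lt A a b ∧ ¬ p.Lt A b a := by
  constructor
  · rintro ⟨ha, hb, h1, h2⟩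
    exact ⟨ha, hb, fun h => h2 h.2.2, fun h => h1 h.2.2⟩
  · rintro ⟨ha, hb, h1, h2⟩
    exact ⟨ha, hb, fun h => h2 ⟨hb, ha, h⟩, fun h => h1 ⟨ha, hb, h⟩⟩

theorem IsWeaklyRegular.isMorley_iff (h : p.IsWeaklyRegular A) (h' : p.IsAsymmetric A)
    {I : Type*} [LinearOrder I] {a : I → C} :
    p.IsMorley A a ↔ (∀ i, p.Realizes A (a i)) ∧ ∀ i j, i < j → p.Lt A (a i) (a j) := by
  constructor
  · intro hm
    have hP : ∀ i, p.Realizes A (a i) := fun i => (hm i).anti Set.subset_union_left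
    refine ⟨hP, fun i j hij => ?_⟩
    exact ⟨hP i, hP j, (hm j).anti (Set.insert_subset (Or.inr ⟨i, hij, rfl⟩) Set.subset_union_left)⟩
  · rintro ⟨hP, hl⟩ i
    refine (h.realizes_union_iff h' ?_).2 ⟨hP i, ?_⟩
    · rintro _ ⟨j, -, rfl⟩
      exact hP j
    · rintro _ ⟨j, hj, rfl⟩
      exact hl j i hj

end Order

end GlobalType
end AsymType

/-! ### Types of increasing sequences -/

namespace AsymType
namespace GlobalType

section Homogeneity

variable {L : FirstOrder.Language.{u, v}} {C : Type w} [L.Structure C] {p : GlobalType L C}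
  {A : Set C}

theorem realizes_of_sameTp {ι : Type*} {a a' : ι → C} (hs : SameTp L A a a') {i : ι}
    (hi : p.Realizes A (a i)) : p.Realizes A (a' i) :=
  realizes_iff.2 fun D hD hl => hs _ (definable_of_definable₁ hD i) (realizes_iff.1 hi D hD hl)

theorem IsInvariant.lt_of_sameTp (h : p.IsInvariant A) {ι : Type*} {a a' : ι → C}
    (hs : SameTp L A a a') {i j : ι} (hl : p.Lt A (a i) (a j)) : p.Lt A (a' i) (a' j) := by
  refine ⟨realizes_of_sameTp hs hl.1, realizes_of_sameTp hs hl.2.1, ?_⟩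
  have hr : ∀ z : C, insert z A = A ∪ Set.range (fun _ : Fin 1 => z) := fun z => by simp
  rw [hr]
  refine realizes_iff.2 fun D hD hlD => ?_
  obtain ⟨R, hR, rfl⟩ := exists_fiber_of_definable hD
  replace hlD := (h.large_fiber_iff (hs.comp fun _ : Fin 1 => i) hR).2 hlD
  have h1 : a j ∈ fiber R (fun _ => a i) :=
    realizes_iff.1 ((hr (a i)).symm ▸ hl.2.2) _ (definable_fiber hR _) hlD
  have h2 := hs.comp (Sum.elim (fun _ : Fin 1 => i) fun _ : Fin 1 => j)
  rw [Sum.comp_elim, Sum.comp_elim] at h2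
  exact h2 R hR h1

theorem memE_of_sameTp (h : p.IsInvariant A) {ι : Type*} {a a' : ι → C}
    (hs : SameTp L A a a') {i j : ι} (he : p.MemE A (a i) (a j)) : p.MemE A (a' i) (a' j) := by
  rw [memE_iff] at he ⊢
  exact ⟨realizes_of_sameTp hs he.1, realizes_of_sameTp hs he.2.1,
    fun hl => he.2.2.1 (h.lt_of_sameTp hs.symm hl), fun hl => he.2.2.2 (h.lt_of_sameTp hs.symm hl)⟩

theorem IsAsymmetric.lt_irrefl (h' : p.IsAsymmetric A) (x : C) : ¬ p.Lt A x x :=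
  fun hl => h'.lt_asymm hl hl

theorem IsWeaklyRegular.sameTp_fin (h : p.IsWeaklyRegular A) (h' : p.IsAsymmetric A) :
    ∀ (n : ℕ) (a a' : Fin n → C), (∀ i, p.Realizes A (a i)) → (∀ i, p.Realizes A (a' i)) →
      (∀ i j, i ≠ j → (p.Lt A (a i) (a j) ∧ p.Lt A (a' i) (a' j)) ∨
        (p.Lt A (a j) (a i) ∧ p.Lt A (a' j) (a' i))) → SameTp L A a a' := by
  intro n
  induction n with
  | zero =>
    intro a a' _ _ _
    rw [Subsingleton.elim a' a]
    exact fun _ _ h => h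
  | succ n ih =>
    intro a a' ha ha' hl
    let r : Fin (n + 1) → Fin (n + 1) → Prop := fun i j => p.Lt A (a j) (a i)
    have : IsTrans _ r := ⟨fun i j k hij hjk => h.lt_trans h' hjk hij⟩
    have : Std.Irrefl r := ⟨fun i => h'.lt_irrefl _⟩
    -- The largest entry realizes `p` over the other ones.
    obtain ⟨i, -, hi⟩ := (Finite.wellFounded_of_trans_of_irrefl r).has_min Set.univ
      Set.univ_nonempty
    have hmax : ∀ j, j ≠ i → p.Lt A (a j) (a i) ∧ p.Lt A (a' j) (a' i) := fun j hj =>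
      (hl j i hj).resolve_right fun hn => hi j trivial hn.1
    have key := h.1.sameTp_sumElim (c := a i) (c' := a' i)
      (ih (a ∘ i.succAbove) (a' ∘ i.succAbove) (fun j => ha _)
      (fun j => ha' _) fun j k hjk => hl _ _ fun he => hjk (Fin.succAbove_right_injective he))
      ((h.realizes_union_iff h' (by rintro _ ⟨j, rfl⟩; exact ha _)).2 ⟨ha i, by
        rintro _ ⟨j, rfl⟩; exact (hmax _ (Fin.succAbove_ne i j)).1⟩)
      ((h.realizes_union_iff h' (by rintro _ ⟨j, rfl⟩; exact ha' _)).2 ⟨ha' i, by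
        rintro _ ⟨j, rfl⟩; exact (hmax _ (Fin.succAbove_ne i j)).2⟩)
    have key' := key.comp (i.insertNth (α := fun _ => Fin n ⊕ Fin 1) (Sum.inr 0) Sum.inl)
    have hc : ∀ b : Fin (n + 1) → C, Sum.elim (b ∘ i.succAbove) (fun _ : Fin 1 => b i) ∘
        i.insertNth (α := fun _ => Fin n ⊕ Fin 1) (Sum.inr 0) Sum.inl = b := by
      intro b
      funext j
      rcases Fin.eq_self_or_eq_succAbove i j with rfl | ⟨k, rfl⟩
      · simp
      · simp
    rwa [hc, hc] at key'

/-- Finite families of pairwise comparable elements of the locus that are ordered in the same way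
have the same type. -/
theorem IsWeaklyRegular.sameTp_of_lt (h : p.IsWeaklyRegular A) (h' : p.IsAsymmetric A)
    {ι : Type*} [Finite ι] {a a' : ι → C} (ha : ∀ i, p.Realizes A (a i))
    (ha' : ∀ i, p.Realizes A (a' i))
    (hl : ∀ i j, i ≠ j → (p.Lt A (a i) (a j) ∧ p.Lt A (a' i) (a' j)) ∨
        (p.Lt A (a j) (a i) ∧ p.Lt A (a' j) (a' i))) : SameTp L A a a' := by
  obtain ⟨n, ⟨e⟩⟩ := Finite.exists_equiv_fin ι
  have key := (h.sameTp_fin h' n (a ∘ e.symm) (a' ∘ e.symm) (fun _ => ha _) (fun _ => ha' _)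
    fun i j hij => hl _ _ fun he => hij (e.symm.injective he)).comp e
  simpa [Function.comp_assoc] using key

variable {κ : Cardinal.{w}}

theorem exists_forall_lt (hκ : ℵ₀ ≤ κ) (hC : IsSaturated L C κ) (hA : #A < κ) (F : Finset C)
    (hF : ∀ x ∈ F, p.Realizes A x) : ∃ c, p.Realizes A c ∧ ∀ x ∈ F, p.Lt A x c := by
  have hB : #(A ∪ F : Set C) < κ :=
    (Cardinal.mk_union_le _ _).trans_lt (Cardinal.add_lt_of_lt hκ hA
      (F.finite_toSet.lt_aleph0.trans_le hκ))
  obtain ⟨c, hc⟩ := exists_realizes (p := p) hC hB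
  have hcA := hc.anti Set.subset_union_left
  exact ⟨c, hcA, fun x hx => ⟨hF x hx, hcA,
    hc.anti (Set.insert_subset (Or.inr hx) Set.subset_union_left)⟩⟩

theorem exists_gt (hκ : ℵ₀ ≤ κ) (hC : IsSaturated L C κ) (hA : #A < κ) {x : C}
    (hx : p.Realizes A x) : ∃ c, p.Lt A x c := by
  obtain ⟨c, -, hc⟩ := exists_forall_lt hκ hC hA {x} (by simpa using hx)
  exact ⟨c, hc x (by simp)⟩

theorem IsAsymmetric.exists_lt (h' : p.IsAsymmetric A) (hκ : ℵ₀ ≤ κ) (hC : IsSaturated L C κ)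
    (hA : #A < κ) {x : C} (hx : p.Realizes A x) : ∃ c, p.Lt A c x := by
  obtain ⟨a, b, hab, -⟩ := h'.exists_pair
  obtain ⟨c, hc⟩ := hC.exists_sameTp hκ hA (h'.1.sameTp_single hab.2.1 hx) a
  exact ⟨c, h'.1.lt_of_sameTp hc (i := Sum.inr 0) (j := Sum.inl 0) hab⟩

theorem IsInvariant.exists_between (h : p.IsInvariant A) (hκ : ℵ₀ ≤ κ) (hC : IsSaturated L C κ)
    (hA : #A < κ) {a b : C} (hab : p.Lt A a b) : ∃ c, p.Lt A a c ∧ p.Lt A c b := by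
  classical
  obtain ⟨c, hac⟩ := exists_gt hκ hC hA hab.1
  obtain ⟨d, -, hd⟩ := exists_forall_lt hκ hC hA {a, c} (by
    simp only [Finset.mem_insert, Finset.mem_singleton]
    rintro x (rfl | rfl)
    exacts [hac.1, hac.2.1])
  have had := hd a (by simp)
  have hcd := hd c (by simp)
  obtain ⟨c', hc'⟩ := hC.exists_sameTp hκ hA (h.sameTp_pair had hab) c
  exact ⟨c', h.lt_of_sameTp hc' (i := Sum.inl 0) (j := Sum.inr 0) hac,
    h.lt_of_sameTp hc' (i := Sum.inr 0) (j := Sum.inl 1) hcd⟩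

end Homogeneity

/-! ### The linear order of classes and maximal Morley sequences -/

section Classes

variable {L : FirstOrder.Language.{u, v}} {C : Type w} [L.Structure C] {p : GlobalType L C}
  {A : Set C}

/-- The locus in `C` of the restriction of `p` to `A`. The hypotheses on `p` are arguments so that
they are available to the order structure on it. -/
def Locus (_ : p.IsWeaklyRegular A) (_ : p.IsAsymmetric A) : Type w := {x : C // p.Realizes A x}

variable {h : p.IsWeaklyRegular A} {h' : p.IsAsymmetric A}

instance : Preorder (Locus h h') where
  le x y := ¬ p.Lt A y.1 x.1
  lt x y := p.Lt A x.1 y.1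
  le_refl _ := h'.lt_irrefl _
  le_trans _ y _ hxy hyz hzx := (h.lt_or_lt hzx y.2).elim hyz hxy
  lt_iff_le_not_ge _ _ := ⟨fun hl => ⟨h'.lt_asymm hl, not_not_intro hl⟩, fun hl => not_not.1 hl.2⟩

instance : @Std.Total (Locus h h') (· ≤ ·) :=
  ⟨fun _ _ => or_iff_not_imp_left.2 fun hn => h'.lt_asymm (not_not.1 hn)⟩

variable (h h') in
/-- The linear order of the `𝓔`-classes of elements of the locus. -/
def Classes : Type w := Antisymmetrization (Locus h h') (· ≤ ·)

open Classical in
noncomputable instance : LinearOrder (Classes h h') :=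
  inferInstanceAs (LinearOrder (Antisymmetrization (Locus h h') (· ≤ ·)))

/-- The `𝓔`-class of an element of the locus. -/
def toClass (h : p.IsWeaklyRegular A) (h' : p.IsAsymmetric A) (x : C) (hx : p.Realizes A x) :
    Classes h h' :=
  toAntisymmetrization (α := Locus h h') (· ≤ ·) ⟨x, hx⟩

theorem toClass_le_toClass {x y : C} {hx : p.Realizes A x} {hy : p.Realizes A y} :
    toClass h h' x hx ≤ toClass h h' y hy ↔ ¬ p.Lt A y x := Iff.rfl

theorem toClass_lt_toClass {x y : C} {hx : p.Realizes A x} {hy : p.Realizes A y} :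
    toClass h h' x hx < toClass h h' y hy ↔ p.Lt A x y := by
  rw [← not_le, toClass_le_toClass, not_not]

theorem toClass_eq_toClass {x y : C} {hx : p.Realizes A x} {hy : p.Realizes A y} :
    toClass h h' x hx = toClass h h' y hy ↔ p.MemE A x y := by
  rw [memE_iff, le_antisymm_iff, toClass_le_toClass, toClass_le_toClass]
  tauto

theorem exists_eq_toClass (q : Classes h h') : ∃ x hx, q = toClass h h' x hx := by
  induction q using Antisymmetrization.ind with
  | _ x => exact ⟨x.1, x.2, rfl⟩

/-- A Morley sequence in `X` is maximal exactly when it meets the `𝓔`-class of each element of the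
locus that lies in `X`. -/
theorem isMaximalMorley_iff (h : p.IsWeaklyRegular A) (h' : p.IsAsymmetric A) {X : Set C}
    {I : Type i} [LinearOrder I] {a : I → C} :
    p.IsMaximalMorley A X a ↔ p.IsMorley A a ∧ (∀ i, a i ∈ X) ∧
      ∀ x ∈ X, p.Realizes A x → ∃ i, p.MemE A x (a i) := by
  refine and_congr_right fun hm => and_congr_right fun hX => ?_
  obtain ⟨hP, hlt⟩ := (h.isMorley_iff h').1 hm
  constructor
  · intro hmax x hx hxP
    by_contra! hn
    let J : Set C := insert x (Set.range a)
    have hJP : ∀ y ∈ J, p.Realizes A y := by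
      rintro _ (rfl | ⟨i, rfl⟩)
      exacts [hxP, hP i]
    have hinj : Function.Injective fun y : J => toClass h h' y (hJP y y.2) := by
      rintro ⟨y, hy⟩ ⟨z, hz⟩ hyz
      replace hyz := toClass_eq_toClass.1 hyz
      rw [Subtype.mk_eq_mk]
      rcases hy with rfl | ⟨i, rfl⟩ <;> rcases hz with rfl | ⟨j, rfl⟩
      · rfl
      · exact (hn j hyz).elim
      · rw [memE_iff] at hyz
        exact (hn i (memE_iff.2 ⟨hyz.2.1, hyz.1, hyz.2.2.2, hyz.2.2.1⟩)).elim
      · rw [memE_iff] at hyz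
        rcases lt_trichotomy i j with hij | rfl | hij
        · exact (hyz.2.2.1 (hlt i j hij)).elim
        · rfl
        · exact (hyz.2.2.2 (hlt j i hij)).elim
    -- Add `x` to the sequence, as an increasing sequence indexed by its own set of entries.
    let _ : LinearOrder J := LinearOrder.lift' _ hinj
    have hJ : ∀ y z : J, y < z ↔ p.Lt A y z := fun y z =>
      (toClass_lt_toClass (h := h) (h' := h') (hx := hJP y y.2) (hy := hJP z z.2))
    have hJm : p.IsMorley A (Subtype.val : J → C) :=
      (h.isMorley_iff h').2 ⟨fun y => hJP y y.2, fun y z hyz => (hJ y z).1 hyz⟩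
    have hJX : ∀ y : J, (y : C) ∈ X := by
      rintro ⟨_, rfl | ⟨i, rfl⟩⟩
      exacts [hx, hX i]
    let e : I ↪o J := OrderEmbedding.ofStrictMono (fun i => ⟨a i, Or.inr ⟨i, rfl⟩⟩)
      fun i j hij => (hJ _ _).2 (hlt i j hij)
    obtain ⟨i, hi⟩ := hmax J Subtype.val hJm hJX e (fun _ => rfl) ⟨x, Or.inl rfl⟩
    have hi' : a i = x := congrArg Subtype.val hi
    have := hn i
    rw [hi', memE_iff] at this
    exact this ⟨hxP, hxP, h'.lt_irrefl x, h'.lt_irrefl x⟩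
  · intro hcov J _ b hb hbX e he j
    obtain ⟨hbP, hblt⟩ := (h.isMorley_iff h').1 hb
    obtain ⟨i, hi⟩ := hcov (b j) (hbX j) (hbP j)
    refine ⟨i, ?_⟩
    rw [← he, memE_iff] at hi
    rcases lt_trichotomy (e i) j with hij | hij | hij
    · exact (hi.2.2.2 (hblt _ _ hij)).elim
    · exact hij
    · exact (hi.2.2.1 (hblt _ _ hij)).elim

variable (h h') in
/-- The classes of elements of the locus that meet `X`. -/
def classesIn (X : Set C) : Set (Classes h h') :=
  {q | ∃ x ∈ X, ∃ hx, q = toClass h h' x hx}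

theorem IsMaximalMorley.nonempty_orderIso (h : p.IsWeaklyRegular A) (h' : p.IsAsymmetric A)
    {X : Set C} {I : Type i} [LinearOrder I] {a : I → C} (ha : p.IsMaximalMorley A X a) :
    Nonempty (I ≃o classesIn h h' X) := by
  obtain ⟨hm, hX, hcov⟩ := (isMaximalMorley_iff h h').1 ha
  obtain ⟨hP, hlt⟩ := (h.isMorley_iff h').1 hm
  let f : I → classesIn h h' X := fun i => ⟨toClass h h' (a i) (hP i), a i, hX i, hP i, rfl⟩
  have hf : StrictMono f := fun i j hij => toClass_lt_toClass.2 (hlt i j hij)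
  refine ⟨hf.orderIsoOfSurjective f ?_⟩
  rintro ⟨_, x, hx, hxP, rfl⟩
  obtain ⟨i, hi⟩ := hcov x hx hxP
  exact ⟨i, Subtype.ext (toClass_eq_toClass.2 hi).symm⟩

theorem IsMaximalMorley.invIs (h : p.IsWeaklyRegular A) (h' : p.IsAsymmetric A) {X : Set C}
    {I : Type i} [LinearOrder I] {a : I → C} (ha : p.IsMaximalMorley A X a) : p.InvIs A X I := by
  refine ⟨⟨a, ha⟩, fun J _ b hb => ?_⟩
  obtain ⟨e⟩ := ha.nonempty_orderIso h h'
  obtain ⟨f⟩ := hb.nonempty_orderIso h h'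
  exact ⟨e.trans f.symm⟩

theorem exists_invIs (h : p.IsWeaklyRegular A) (h' : p.IsAsymmetric A) (X : Set C) :
    ∃ (I : Type w) (_ : LinearOrder I), p.InvIs A X I := by
  refine ⟨classesIn h h' X, inferInstance, ?_⟩
  choose a haX haP ha using fun q : classesIn h h' X => q.2
  refine IsMaximalMorley.invIs h h' (a := a) ((isMaximalMorley_iff h h').2
    ⟨(h.isMorley_iff h').2 ⟨haP, fun q r hqr => ?_⟩, haX, fun x hx hxP => ?_⟩)
  · rw [← toClass_lt_toClass (h := h) (h' := h') (hx := haP q) (hy := haP r), ← ha, ← ha]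
    exact hqr
  · refine ⟨⟨toClass h h' x hxP, x, hx, hxP, rfl⟩, ?_⟩
    rw [← toClass_eq_toClass (h := h) (h' := h') (hx := hxP) (hy := haP _), ← ha]

/-- Every countable linear order indexes a Morley sequence, as the linear order of classes is
dense. -/
theorem exists_isMorley (h : p.IsWeaklyRegular A) (h' : p.IsAsymmetric A) {κ : Cardinal.{w}}
    (hκ : ℵ₀ ≤ κ) (hC : IsSaturated L C κ) (hA : #A < κ) (I : Type i) [LinearOrder I]
    [Countable I] : ∃ a : I → C, p.IsMorley A a := by
  have : DenselyOrdered (Classes h h') := ⟨fun q r hqr => by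
    obtain ⟨x, hx, rfl⟩ := exists_eq_toClass q
    obtain ⟨y, hy, rfl⟩ := exists_eq_toClass r
    obtain ⟨z, h1, h2⟩ := h.1.exists_between hκ hC hA (toClass_lt_toClass.1 hqr)
    exact ⟨toClass h h' z h1.2.1, toClass_lt_toClass.2 h1, toClass_lt_toClass.2 h2⟩⟩
  have : Nontrivial (Classes h h') := by
    obtain ⟨x, y, hxy, -⟩ := h'.exists_pair
    exact ⟨toClass h h' x hxy.1, toClass h h' y hxy.2.1, (toClass_lt_toClass.2 hxy).ne⟩
  obtain ⟨e⟩ := Order.embedding_from_countable_to_dense I (Classes h h')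
  choose a ha hea using fun i => exists_eq_toClass (e i)
  refine ⟨a, (h.isMorley_iff h').2 ⟨ha, fun i j hij => ?_⟩⟩
  rw [← toClass_lt_toClass (h := h) (h' := h') (hx := ha i) (hy := ha j), ← hea, ← hea]
  exact e.strictMono hij

end Classes

end GlobalType
end AsymType

/-! ### Omitting types in a saturated structure -/

namespace AsymType

section OmittingTypes

variable {L : FirstOrder.Language.{u, v}} {C : Type w} [L.Structure C]

/-- The set `K` is not isolated over `B`: it includes no nonempty `B`-definable set. -/
def NonIsolated (L : FirstOrder.Language.{u, v}) [L.Structure C] (K B : Set C) : Prop :=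
  ∀ D : Set C, B.Definable₁ L D → D.Nonempty → ¬ D ⊆ K

theorem NonIsolated.iUnion {K : Set C} {B : ℕ → Set C} (hB : Monotone B)
    (h : ∀ n, NonIsolated L K (B n)) : NonIsolated L K (⋃ n, B n) := by
  intro D hD
  obtain ⟨F, hF, hd⟩ := Set.definable_iff_finitely_definable.1 hD
  obtain ⟨n, hn⟩ := (directed_of_isDirected_le hB).exists_mem_subset_of_finset_subset_biUnion hF
  exact h n D (Set.Definable.mono hd hn)

theorem definable₁_singleton {B : Set C} {c : C} (hc : c ∈ B) : B.Definable₁ L {c} :=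
  Set.Definable.singleton_of_mem L hc

theorem definable_exists_left {B : Set C} {R : Set (Fin 2 → C)} (hR : B.Definable L R) :
    B.Definable₁ L {y | ∃ x, ![x, y] ∈ R} := by
  have := definable_exists_fiber (hR.preimage_comp (β := Fin 1 ⊕ Fin 1) ![Sum.inr 0, Sum.inl 0])
  rw [Set.Definable₁]
  convert this using 1
  ext v
  refine exists_congr fun c => iff_of_eq (congrArg (· ∈ R) ?_)
  funext k; fin_cases k <;> rfl

theorem definable_exists_right {B : Set C} {R : Set (Fin 2 → C)} (hR : B.Definable L R) :
    B.Definable₁ L {x | ∃ y, ![x, y] ∈ R} := by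
  have := definable_exists_fiber (hR.preimage_comp (β := Fin 1 ⊕ Fin 1) ![Sum.inl 0, Sum.inr 0])
  rw [Set.Definable₁]
  convert this using 1
  ext v
  refine exists_congr fun c => iff_of_eq (congrArg (· ∈ R) ?_)
  funext k; fin_cases k <;> rfl

variable {κ : Cardinal.{w}} {J : Type*}

/-- The successor step of the omitting types construction: a nonempty definable set has an element
over which the type to be omitted remains non-isolated. -/
theorem NonIsolated.exists_insert (hκ : ℵ₀ < κ) (hC : IsSaturated L C κ) (hL : L.card ≤ ℵ₀)
    {G : J → Set C} {B : Set C} (hB : B.Countable) (hG : ∀ j, B.Definable₁ L (G j))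
    (h : NonIsolated L (⋂ j, G j) B) {D : Set C} (hD : B.Definable₁ L D) (hne : D.Nonempty) :
    ∃ c ∈ D, NonIsolated L (⋂ j, G j) (insert c B) := by
  obtain ⟨R, hR⟩ := (countable_definable (α := Fin 2) hL hB).exists_eq_range
    ⟨Set.univ, Set.definable_univ⟩
  have hRd : ∀ n, B.Definable L (R n) := fun n => by
    have : R n ∈ Set.range R := ⟨n, rfl⟩
    rwa [← hR] at this
  let S := {E : Set C // B.Definable₁ L E ∧ E.Nonempty}
  -- Each requirement is met on a smaller nonempty definable set.
  have step : ∀ (n : ℕ) (E : S), ∃ E' : S, E'.1 ⊆ E.1 ∧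
      ((∀ y ∈ E'.1, ¬ ∃ x, ![x, y] ∈ R n) ∨ ∃ j, ∀ y ∈ E'.1, ∃ x, ![x, y] ∈ R n ∧ x ∉ G j) := by
    rintro n ⟨E, hE, hEne⟩
    by_cases hc : ∃ y ∈ E, ¬ ∃ x, ![x, y] ∈ R n
    · exact ⟨⟨E ∩ {y | ∃ x, ![x, y] ∈ R n}ᶜ, Set.Definable.inter hE
        (Set.Definable.compl (definable_exists_left (hRd n))), hc⟩, Set.inter_subset_left,
        Or.inl fun y hy => hy.2⟩
    · push Not at hc
      obtain ⟨y₀, hy₀⟩ := hEne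
      obtain ⟨x₀, hx₀⟩ := hc y₀ hy₀
      have hd : B.Definable₁ L {x | ∃ y, ![x, y] ∈ R n ∩ {v | v 1 ∈ E}} :=
        definable_exists_right ((hRd n).inter (definable_of_definable₁ hE 1))
      obtain ⟨x, ⟨y, hxy, hyE⟩, hx⟩ := Set.not_subset.1 (h _ hd ⟨x₀, y₀, hx₀, hy₀⟩)
      obtain ⟨j, hj⟩ := not_forall.1 fun hn => hx (Set.mem_iInter.2 hn)
      refine ⟨⟨E ∩ {y | ∃ x, ![x, y] ∈ R n ∩ {v | v 0 ∈ G j}ᶜ}, Set.Definable.inter hE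
        (definable_exists_left ((hRd n).inter (definable_of_definable₁ (hG j) 0).compl)),
        y, hyE, x, hxy, hj⟩, Set.inter_subset_left, Or.inr ⟨j, fun z hz => hz.2⟩⟩
  choose f hf hf' using step
  let E : ℕ → S := fun n => Nat.rec ⟨D, hD, hne⟩ (fun n E => f n E) n
  have hanti : Antitone fun n => (E n).1 := antitone_nat_of_succ_le fun n => hf n (E n)
  obtain ⟨c, hc⟩ := hC.iInter_nonempty ((Cardinal.le_aleph0_iff_set_countable.2 hB).trans_lt hκ)
    (D := fun n => (E n).1) (fun n => (E n).2.1)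
    (directed_of_isDirected_le hanti) (fun n => (E n).2.2)
  rw [Set.mem_iInter] at hc
  refine ⟨c, hc 0, ?_⟩
  intro D' hD' hne' hsub
  have hr : insert c B = B ∪ Set.range (fun _ : Fin 1 => c) := by simp
  rw [hr] at hD'
  obtain ⟨R', hR', rfl⟩ := exists_fiber_of_definable hD'
  obtain ⟨n, hn⟩ := hR.subset
    (hR'.preimage_comp (β := Fin 2) (Sum.elim (fun _ => 1) fun _ => 0))
  have hiff : ∀ x, x ∈ fiber R' (fun _ => c) ↔ ![x, c] ∈ R n := by
    intro x
    rw [hn, Set.mem_preimage, mem_fiber]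
    refine iff_of_eq (congrArg (· ∈ R') ?_)
    funext k; rcases k with k | k <;> rfl
  rcases hf' n (E n) with h1 | ⟨j, hj⟩
  · obtain ⟨x, hx⟩ := hne'
    exact h1 c (hc (n + 1)) ⟨x, (hiff x).1 hx⟩
  · obtain ⟨x, hx, hxG⟩ := hj c (hc (n + 1))
    exact hxG (Set.mem_iInter.1 (hsub ((hiff x).2 hx)) j)

/-- The omitting types theorem, inside a saturated structure. -/
theorem NonIsolated.exists_elementarySubstructure (hκ : ℵ₀ < κ) (hC : IsSaturated L C κ)
    (hL : L.card ≤ ℵ₀) {G : J → Set C} {B : Set C} (hB : B.Countable)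
    (hG : ∀ j, B.Definable₁ L (G j)) (h : NonIsolated L (⋂ j, G j) B) :
    ∃ M : L.ElementarySubstructure C, B ⊆ (M : Set C) ∧ (M : Set C).Countable ∧
      ∀ c ∈ M, c ∉ ⋂ j, G j := by
  let S := {B' : Set C // B ⊆ B' ∧ B'.Countable ∧ NonIsolated L (⋂ j, G j) B'}
  have union : ∀ B' : ℕ → S, (Monotone fun n => (B' n).1) → ∃ B'' : S, B''.1 = ⋃ n, (B' n).1 :=
    fun B' hmono => ⟨⟨⋃ n, (B' n).1, (B' 0).2.1.trans (Set.subset_iUnion (fun n => (B' n).1) 0),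
      Set.countable_iUnion fun n => (B' n).2.2.1,
      NonIsolated.iUnion hmono fun n => (B' n).2.2.2⟩, rfl⟩
  -- One nonempty definable set is met at a time.
  have step₁ : ∀ (B' : S) (D : Set C), ∃ B'' : S, B'.1 ⊆ B''.1 ∧
      (B'.1.Definable₁ L D → D.Nonempty → (D ∩ B''.1).Nonempty) := by
    rintro B' D
    by_cases hD : B'.1.Definable₁ L D ∧ D.Nonempty
    · obtain ⟨c, hc, hc'⟩ := B'.2.2.2.exists_insert hκ hC hL B'.2.2.1
        (fun j => Set.Definable.mono (hG j) B'.2.1) hD.1 hD.2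
      exact ⟨⟨insert c B'.1, B'.2.1.trans (Set.subset_insert _ _), B'.2.2.1.insert c, hc'⟩,
        Set.subset_insert _ _, fun _ _ => ⟨c, hc, Or.inl rfl⟩⟩
    · exact ⟨B', subset_rfl, fun h1 h2 => (hD ⟨h1, h2⟩).elim⟩
  have step : ∀ B' : S, ∃ B'' : S, B'.1 ⊆ B''.1 ∧
      ∀ D, B'.1.Definable₁ L D → D.Nonempty → (D ∩ B''.1).Nonempty := by
    intro B'
    obtain ⟨D, hD⟩ := (countable_definable (α := Fin 1) hL B'.2.2.1).exists_eq_range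
      ⟨Set.univ, Set.definable_univ⟩
    choose f hf hf' using step₁
    let E : ℕ → S := fun n => Nat.rec B' (fun n E => f E {c | (fun _ => c) ∈ D n}) n
    have hmono : Monotone fun n => (E n).1 := monotone_nat_of_le_succ fun n => hf (E n) _
    obtain ⟨B'', hB''⟩ := union E hmono
    refine ⟨B'', hB'' ▸ Set.subset_iUnion (fun n => (E n).1) 0, fun D' hD' hne => ?_⟩
    obtain ⟨n, hn⟩ := hD.subset hD'
    have hDn : {c : C | (fun _ => c) ∈ D n} = D' := by
      rw [hn]; rfl
    have hd : (E n).1.Definable₁ L D' := Set.Definable.mono hD' (hmono (Nat.zero_le n))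
    obtain ⟨c, hc, hcE⟩ := hf' (E n) D' hd hne
    refine ⟨c, hc, hB'' ▸ Set.mem_iUnion.2 ⟨n + 1, ?_⟩⟩
    change c ∈ (f (E n) {c | (fun _ => c) ∈ D n}).1
    rwa [hDn]
  choose f hf hf' using step
  let E : ℕ → S := fun n => Nat.rec ⟨B, subset_rfl, hB, h⟩ (fun _ E => f E) n
  have hmono : Monotone fun n => (E n).1 := monotone_nat_of_le_succ fun n => hf (E n)
  obtain ⟨M, hM⟩ := union E hmono
  have hmeet : L.MeetsDefinable M.1 := by
    intro D hne hD
    obtain ⟨F, hF, hd⟩ := Set.definable_iff_finitely_definable.1 hD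
    rw [hM] at hF
    obtain ⟨n, hn⟩ :=
      (directed_of_isDirected_le hmono).exists_mem_subset_of_finset_subset_biUnion hF
    obtain ⟨c, hc, hcE⟩ := hf' (E n) D (Set.Definable.mono hd hn) hne
    exact ⟨c, hc, hM ▸ Set.mem_iUnion.2 ⟨n + 1, hcE⟩⟩
  have hcoe : (hmeet.toElementarySubstructure : Set C) = M.1 := hmeet.closure_eq_self
  refine ⟨hmeet.toElementarySubstructure, M.2.1.trans hcoe.superset, M.2.2.1.mono hcoe.subset, fun c hc hcK => ?_⟩
  have hc' : c ∈ M.1 := hcoe.subset hc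
  exact M.2.2.2 {c} (definable₁_singleton hc') (Set.singleton_nonempty c)
    (Set.singleton_subset_iff.2 hcK)

end OmittingTypes
end AsymType

/-! ### Definable relations that contain all Morley pairs -/

namespace AsymType
namespace GlobalType

section MorleyRelations

variable {L : FirstOrder.Language.{u, v}} {C : Type w} [L.Structure C] {p : GlobalType L C}
  {A : Set C} {κ : Cardinal.{w}}

variable (p A) in
/-- The `A`-definable binary relations that hold for all Morley pairs. They are the formulas of the
type over `A` of any such pair. -/
def IsMorleyRel (χ : C → C → Prop) : Prop :=
  A.Definable L {v : Fin 2 → C | χ (v 0) (v 1)} ∧ ∀ x y, p.Lt A x y → χ x y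

theorem IsMorleyRel.and {χ χ' : C → C → Prop} (hχ : p.IsMorleyRel A χ) (hχ' : p.IsMorleyRel A χ') :
    p.IsMorleyRel A fun x y => χ x y ∧ χ' x y :=
  ⟨hχ.1.inter hχ'.1, fun x y hl => ⟨hχ.2 x y hl, hχ'.2 x y hl⟩⟩

theorem isMorleyRel_true : p.IsMorleyRel A fun _ _ => True :=
  ⟨Set.definable_univ, fun _ _ _ => trivial⟩

theorem pair_eta (v : Fin 2 → C) : ![v 0, v 1] = v := by
  funext k; fin_cases k <;> rfl

/-- The type over `A` of a Morley pair determines that the pair is a Morley sequence. -/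
theorem IsAsymmetric.lt_iff_forall (h' : p.IsAsymmetric A) {x y : C} :
    p.Lt A x y ↔ ∀ χ, p.IsMorleyRel A χ → χ x y := by
  refine ⟨fun hl χ hχ => hχ.2 x y hl, fun hall => ?_⟩
  obtain ⟨a, b, hab, -⟩ := h'.exists_pair
  refine h'.1.lt_of_sameTp (a := ![a, b]) (a' := ![x, y]) (i := 0) (j := 1) (fun R hR hm => ?_) hab
  refine hall (fun x y => ![x, y] ∈ R) ⟨?_, fun x' y' hl => h'.1.sameTp_pair hab hl R hR hm⟩
  simp only [pair_eta]
  exact hR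

theorem IsAsymmetric.exists_isMorleyRel (h' : p.IsAsymmetric A) {x y : C} (hl : ¬ p.Lt A x y) :
    ∃ χ, p.IsMorleyRel A χ ∧ ¬ χ x y := by
  rw [h'.lt_iff_forall] at hl
  push Not at hl
  exact hl

theorem IsAsymmetric.exists_asymm_isMorleyRel (h' : p.IsAsymmetric A) :
    ∃ χ, p.IsMorleyRel A χ ∧ ∀ x y, χ x y → ¬ χ y x := by
  obtain ⟨a, b, hab, -⟩ := h'.exists_pair
  obtain ⟨χ, hχ, hn⟩ := h'.exists_isMorleyRel (h'.lt_asymm hab)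
  refine ⟨fun x y => χ x y ∧ ¬ χ y x, ⟨hχ.1.inter (definable_of_definable₂ hχ.1 1 0).compl,
    fun x y hl => ⟨hχ.2 x y hl, fun hyx => hn ?_⟩⟩, fun x y h1 h2 => h1.2 h2.1⟩
  exact h'.1.sameTp_pair hl hab _ (definable_of_definable₂ hχ.1 1 0) hyx

theorem definable₁_left {B : Set C} (hAB : A ⊆ B) {χ : C → C → Prop}
    (hχ : A.Definable L {v : Fin 2 → C | χ (v 0) (v 1)}) {u : C} (hu : u ∈ B) :
    B.Definable₁ L {z | χ u z} :=
  (definable_specialize_of_mem (ι := Fin 1) (α := Fin 1)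
    (definable_of_definable₂ (hχ.mono hAB) (Sum.inl 0) (Sum.inr 0)) (a := fun _ => u)
    fun _ => hu :)

theorem definable₁_right {B : Set C} (hAB : A ⊆ B) {χ : C → C → Prop}
    (hχ : A.Definable L {v : Fin 2 → C | χ (v 0) (v 1)}) {u : C} (hu : u ∈ B) :
    B.Definable₁ L {z | χ z u} :=
  definable₁_left (χ := fun x y => χ y x) hAB (definable_of_definable₂ hχ 1 0) hu

/-- If every element that lies between `u` and `w` in the Morley order belongs to the definable
set `D`, then so does every element related to `u` and `w` by a suitable definable relation. -/
theorem IsAsymmetric.exists_isMorleyRel_subset (h' : p.IsAsymmetric A)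
    (hC : IsSaturated L C κ) {B : Set C} (hB : #B < κ) (hAB : A ⊆ B) {D : Set C}
    (hD : B.Definable₁ L D) {u w : C} (hu : u ∈ B) (hw : w ∈ B)
    (hz : ∀ z, p.Lt A u z → p.Lt A z w → z ∈ D) :
    ∃ χ, p.IsMorleyRel A χ ∧ ∀ z, χ u z → χ z w → z ∈ D := by
  by_contra! hn
  let I := {χ : C → C → Prop // p.IsMorleyRel A χ}
  have : Nonempty I := ⟨⟨_, isMorleyRel_true⟩⟩
  obtain ⟨z, hzI⟩ := hC.iInter_nonempty hB (D := fun χ : I => {z | χ.1 u z} ∩ ({z | χ.1 z w} ∩ Dᶜ))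
    (fun χ => Set.Definable.inter (definable₁_left hAB χ.2.1 hu)
      (Set.Definable.inter (definable₁_right hAB χ.2.1 hw) (Set.Definable.compl hD)))
    (fun χ χ' => ⟨⟨_, χ.2.and χ'.2⟩, fun z hz => ⟨hz.1.1, hz.2.1.1, hz.2.2⟩,
      fun z hz => ⟨hz.1.2, hz.2.1.2, hz.2.2⟩⟩) (fun χ => hn χ.1 χ.2)
  rw [Set.mem_iInter] at hzI
  exact (hzI ⟨_, isMorleyRel_true⟩).2.2 (hz z
    (h'.lt_iff_forall.2 fun χ hχ => (hzI ⟨χ, hχ⟩).1)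
    (h'.lt_iff_forall.2 fun χ hχ => (hzI ⟨χ, hχ⟩).2.1))

theorem exists_forall_not_of_finset {r : C → C → Prop} (hirr : ∀ x, ¬ r x x)
    (htr : ∀ x y z, r x y → r y z → r x z) {s : Finset C} (hs : s.Nonempty) :
    ∃ m ∈ s, ∀ x ∈ s, ¬ r x m := by
  let r' : s → s → Prop := fun x y => r x y
  have : IsTrans s r' := ⟨fun _ _ _ => htr _ _ _⟩
  have : Std.Irrefl r' := ⟨fun _ => hirr _⟩
  obtain ⟨x, hx⟩ := hs
  obtain ⟨m, -, hm⟩ := (Finite.wellFounded_of_trans_of_irrefl r').has_min Set.univ ⟨⟨x, hx⟩, trivial⟩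
  exact ⟨m, m.2, fun y hy => hm ⟨y, hy⟩ trivial⟩

/-- A nonempty definable subset of the locus that avoids the classes of the parameters from the
locus includes an interval of the Morley order, in a definable manner. An end point of that interval
can be taken among the parameters. -/
theorem exists_interval_subset (h : p.IsWeaklyRegular A) (h' : p.IsAsymmetric A) (hκ : ℵ₀ ≤ κ)
    (hC : IsSaturated L C κ) (hA : #A < κ) {F : Finset C}
    (hF : ∀ f ∈ F, ∀ g ∈ F, f ≠ g → p.Lt A f g ∨ p.Lt A g f) {D : Set C}
    (hD : (A ∪ F).Definable₁ L D) (hne : D.Nonempty)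
    (hDP : ∀ z ∈ D, p.Realizes A z ∧ ∀ f ∈ F, p.Lt A f z ∨ p.Lt A z f) :
    ∃ u w χ, p.Lt A u w ∧ p.IsMorleyRel A χ ∧ (∀ z, χ u z → χ z w → z ∈ D) ∧
      (F.Nonempty → u ∈ F ∨ w ∈ F) := by
  classical
  obtain ⟨c, hc⟩ := hne
  obtain ⟨hcP, hcF⟩ := hDP c hc
  -- `u` is the predecessor of `c` in `F`, if there is one, and `w` its successor.
  obtain ⟨u, huc, hu, huF⟩ : ∃ u, p.Lt A u c ∧ (∀ f ∈ F, p.Lt A f c → ∀ z, p.Lt A u z → p.Lt A f z) ∧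
      ((∃ f ∈ F, p.Lt A f c) → u ∈ F) := by
    by_cases hex : ∃ f ∈ F, p.Lt A f c
    · obtain ⟨f₀, hf₀, hfc₀⟩ := hex
      obtain ⟨u, hu, hmax⟩ := exists_forall_not_of_finset (r := fun x y => p.Lt A y x)
        h'.lt_irrefl (fun x y z hxy hyz => h.lt_trans h' hyz hxy)
        (s := F.filter fun f => p.Lt A f c) ⟨f₀, Finset.mem_filter.2 ⟨hf₀, hfc₀⟩⟩
      rw [Finset.mem_filter] at hu
      refine ⟨u, hu.2, fun f hf hfc z hz => ?_, fun _ => hu.1⟩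
      by_cases hfu : f = u
      · exact hfu ▸ hz
      · exact h.lt_trans h' ((hF f hf u hu.1 hfu).resolve_right
          (hmax f (Finset.mem_filter.2 ⟨hf, hfc⟩))) hz
    · obtain ⟨u, hu⟩ := h'.exists_lt hκ hC hA hcP
      exact ⟨u, hu, fun f hf hfc => (hex ⟨f, hf, hfc⟩).elim, fun he => (hex he).elim⟩
  obtain ⟨w, hcw, hw, hwF⟩ : ∃ w, p.Lt A c w ∧ (∀ f ∈ F, p.Lt A c f → ∀ z, p.Lt A z w → p.Lt A z f) ∧
      ((∃ f ∈ F, p.Lt A c f) → w ∈ F) := by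
    by_cases hex : ∃ f ∈ F, p.Lt A c f
    · obtain ⟨f₀, hf₀, hfc₀⟩ := hex
      obtain ⟨w, hw, hmin⟩ := exists_forall_not_of_finset (r := fun x y => p.Lt A x y)
        h'.lt_irrefl (fun x y z hxy hyz => h.lt_trans h' hxy hyz)
        (s := F.filter fun f => p.Lt A c f) ⟨f₀, Finset.mem_filter.2 ⟨hf₀, hfc₀⟩⟩
      rw [Finset.mem_filter] at hw
      refine ⟨w, hw.2, fun f hf hfc z hz => ?_, fun _ => hw.1⟩
      by_cases hfw : f = w
      · exact hfw ▸ hz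
      · exact h.lt_trans h' hz ((hF f hf w hw.1 hfw).resolve_left
          (hmin f (Finset.mem_filter.2 ⟨hf, hfc⟩)))
    · obtain ⟨w, hw⟩ := exists_gt hκ hC hA hcP
      exact ⟨w, hw, fun f hf hfc => (hex ⟨f, hf, hfc⟩).elim, fun he => (hex he).elim⟩
  have hFP : ∀ f ∈ F, p.Realizes A f := fun f hf => (hcF f hf).elim (fun hl => hl.1) fun hl => hl.2.1
  -- No parameter separates the elements between `u` and `w` from `c`.
  have hbetween : ∀ z, p.Lt A u z → p.Lt A z w → z ∈ D := by
    intro z huz hzw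
    have hr : A ∪ (F : Set C) = A ∪ Set.range (fun f : F => (f : C)) := by simp
    rw [hr] at hD
    obtain ⟨R, hR, rfl⟩ := exists_fiber_of_definable hD
    have hF' : ∀ f : F, (p.Lt A f c ∧ p.Lt A f z) ∨ (p.Lt A c f ∧ p.Lt A z f) := fun f =>
      (hcF f f.2).imp (fun hl => ⟨hl, hu f f.2 hl z huz⟩) fun hl => ⟨hl, hw f f.2 hl z hzw⟩
    refine h.sameTp_of_lt h' (a := Sum.elim (fun f : F => (f : C)) fun _ : Fin 1 => c)
      (a' := Sum.elim (fun f : F => (f : C)) fun _ : Fin 1 => z) ?_ ?_ ?_ R hR hc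
    · rintro (f | k)
      exacts [hFP f f.2, hcP]
    · rintro (f | k)
      exacts [hFP f f.2, huz.2.1]
    · rintro (f | k) (g | l) hij
      · exact (hF f f.2 g g.2 fun he => hij (congrArg Sum.inl (Subtype.ext he))).imp
          (fun hl => ⟨hl, hl⟩) fun hl => ⟨hl, hl⟩
      · exact hF' f
      · exact (hF' g).symm
      · exact (hij (congrArg Sum.inr (Subsingleton.elim k l))).elim
  have hsub : A ∪ (F : Set C) ⊆ A ∪ (insert u (insert w F) : Finset C) :=
    Set.union_subset_union_right _ fun f hf =>
      Finset.mem_coe.2 (Finset.mem_insert_of_mem (Finset.mem_insert_of_mem hf))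
  obtain ⟨χ, hχ, hχD⟩ := h'.exists_isMorleyRel_subset hC
    ((Cardinal.mk_union_le _ _).trans_lt (Cardinal.add_lt_of_lt hκ hA
      ((Finset.finite_toSet _).lt_aleph0.trans_le hκ)))
    Set.subset_union_left (Set.Definable.mono hD hsub) (u := u) (w := w)
    (Or.inr (by simp)) (Or.inr (by simp)) hbetween
  refine ⟨u, w, χ, h.lt_trans h' huc hcw, hχ, hχD, ?_⟩
  rintro ⟨f, hf⟩
  exact (hcF f hf).imp (fun hl => huF ⟨f, hf, hl⟩) fun hl => hwF ⟨f, hf, hl⟩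

/-- A property of the elements related to a Morley pair is shared by all Morley pairs. -/
theorem IsInvariant.exists_transfer (h : p.IsInvariant A) (hκ : ℵ₀ ≤ κ) (hC : IsSaturated L C κ)
    (hA : #A < κ) {u w u' w' : C} (hl : p.Lt A u w) (hl' : p.Lt A u' w') (z' : C) :
    ∃ z, SameTp L A ![u', w', z'] ![u, w, z] := by
  obtain ⟨z, hz⟩ := hC.exists_sameTp hκ hA (h.sameTp_pair hl' hl) z'
  refine ⟨z, ?_⟩
  have key := hz.comp ![Sum.inl 0, Sum.inl 1, Sum.inr 0]
  have hc : ∀ a b c : C, Sum.elim ![a, b] (fun _ : Fin 1 => c) ∘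
      ![Sum.inl 0, Sum.inl 1, Sum.inr 0] = ![a, b, c] := fun a b c => by
    funext k; fin_cases k <;> rfl
  rwa [hc, hc] at key

theorem exists_formula_of_definable {s : Set (Fin 2 → C)} (hs : A.Definable L s) :
    ∃ σ : L[[A]].Formula (Fin 2), ∀ v, σ.Realize v ↔ v ∈ s := by
  obtain ⟨σ, rfl⟩ := hs
  exact ⟨σ, fun v => Iff.rfl⟩

/-- If the elements related by `χ` to both members of a Morley pair are outside of the class of one of
the members, then `χ` is false on each class, so that `p` is simple. -/
theorem isSimple_of_isMorleyRel (h : p.IsWeaklyRegular A) (h' : p.IsAsymmetric A) (hκ : ℵ₀ ≤ κ)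
    (hC : IsSaturated L C κ) (hA : #A < κ) {χ : C → C → Prop} (hχ : p.IsMorleyRel A χ) {u w : C}
    (huw : p.Lt A u w) (hE : (∀ z, χ u z → χ z w → ¬ p.MemE A z u) ∨
      ∀ z, χ u z → χ z w → ¬ p.MemE A z w) : p.IsSimple A := by
  have key : ∀ x y, p.MemE A x y → ¬ χ x y := by
    intro x y hxy hχxy
    have hxy' := memE_iff.1 hxy
    rcases hE with hE | hE
    · obtain ⟨b, hxb⟩ := exists_gt hκ hC hA hxy.1
      have hyb := (h.lt_or_lt hxb hxy.2.1).resolve_left hxy'.2.2.1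
      obtain ⟨z, hz⟩ := h.1.exists_transfer hκ hC hA huw hxb y
      refine hE z (hz _ (definable_of_definable₂ hχ.1 0 2) hχxy)
        (hz _ (definable_of_definable₂ hχ.1 2 1) (hχ.2 y b hyb)) ?_
      refine memE_of_sameTp h.1 hz (i := 2) (j := 0) ?_
      exact memE_iff.2 ⟨hxy'.2.1, hxy'.1, hxy'.2.2.2, hxy'.2.2.1⟩
    · obtain ⟨b, hby⟩ := h'.exists_lt hκ hC hA hxy.2.1
      have hbx := (h.lt_or_lt hby hxy.1).resolve_right hxy'.2.2.1
      obtain ⟨z, hz⟩ := h.1.exists_transfer hκ hC hA huw hby x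
      refine hE z (hz _ (definable_of_definable₂ hχ.1 0 2) (hχ.2 b x hbx))
        (hz _ (definable_of_definable₂ hχ.1 2 1) hχxy) ?_
      exact memE_of_sameTp h.1 hz (i := 2) (j := 1) hxy
  obtain ⟨σ, hσ⟩ := exists_formula_of_definable
    (hχ.1.compl.inter (definable_of_definable₂ hχ.1 (1 : Fin 2) 0).compl)
  refine ⟨σ, fun a b ha hb => ?_⟩
  rw [hσ]
  constructor
  · rintro ⟨h1, h2⟩
    exact memE_iff.2 ⟨ha, hb, fun hl => h1 (hχ.2 a b hl), fun hl => h2 (hχ.2 b a hl)⟩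
  · intro he
    have he' := memE_iff.1 he
    exact ⟨key a b he, key b a (memE_iff.2 ⟨hb, ha, he'.2.2.2, he'.2.2.1⟩)⟩

/-- If the elements related by `χ` to both members of a Morley pair are in the locus, then `p` is
convex. The witness is the strict part of the definable preorder that compares the sets of elements
above, and the sets of elements below, in the sense of `χ`. -/
theorem isConvex_of_isMorleyRel (h : p.IsWeaklyRegular A) (h' : p.IsAsymmetric A) (hκ : ℵ₀ ≤ κ)
    (hC : IsSaturated L C κ) (hA : #A < κ) {χ : C → C → Prop} (hχ : p.IsMorleyRel A χ) {u w : C}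
    (huw : p.Lt A u w) (hP : ∀ z, χ u z → χ z w → p.Realizes A z) : p.IsConvex A := by
  classical
  obtain ⟨χ₀, hχ₀, hasymm⟩ := h'.exists_asymm_isMorleyRel
  let χ₁ : C → C → Prop := fun x y => χ x y ∧ χ₀ x y
  have hχ₁ : p.IsMorleyRel A χ₁ := hχ.and hχ₀
  have hasymm₁ : ∀ x y, χ₁ x y → ¬ χ₁ y x := fun x y h1 h2 => hasymm x y h1.2 h2.2
  let T : C → C → C → Prop := fun x y z => (χ₁ y z → χ₁ x z) ∧ (χ₁ z x → χ₁ z y)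
  have hT : A.Definable L {v : Fin 3 → C | T (v 0) (v 1) (v 2)} :=
    (definable_imp (definable_of_definable₂ hχ₁.1 1 2) (definable_of_definable₂ hχ₁.1 0 2)).inter
      (definable_imp (definable_of_definable₂ hχ₁.1 2 0) (definable_of_definable₂ hχ₁.1 2 1))
  -- On the locus, `χ₁ x y` implies that `y` is not below `x`.
  have hTP : ∀ x y z, p.Lt A x y → p.Realizes A z → T x y z := by
    intro x y z hxy hz
    refine ⟨fun hyz => hχ₁.2 x z ?_, fun hzx => hχ₁.2 z y ?_⟩
    · exact (h.lt_or_lt hxy hz).resolve_right fun hzy => hasymm₁ _ _ hyz (hχ₁.2 z y hzy)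
    · exact (h.lt_or_lt hxy hz).resolve_left fun hxz => hasymm₁ _ _ hzx (hχ₁.2 x z hxz)
  -- By saturation, the locus can be replaced by an `A`-definable set that includes it.
  obtain ⟨Δ, hΔ, hΔl, hTΔ⟩ : ∃ Δ, A.Definable₁ L Δ ∧ p.Large Δ ∧ ∀ z ∈ Δ, T u w z := by
    by_contra! hn
    let I := {Δ : Set C // A.Definable₁ L Δ ∧ p.Large Δ}
    have : Nonempty I := ⟨⟨Set.univ, Set.definable_univ, large_univ⟩⟩
    have hTd : (A ∪ Set.range ![u, w]).Definable₁ L {z | T u w z} := by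
      refine definable_fiber (R := {v : Fin 2 ⊕ Fin 1 → C | T (v (Sum.inl 0)) (v (Sum.inl 1))
        (v (Sum.inr 0))}) ?_ ![u, w]
      exact hT.preimage_comp ![Sum.inl 0, Sum.inl 1, Sum.inr 0]
    obtain ⟨z, hz⟩ := hC.iInter_nonempty (B := A ∪ Set.range ![u, w])
      ((Cardinal.mk_union_le _ _).trans_lt (Cardinal.add_lt_of_lt hκ hA
        ((Set.finite_range _).lt_aleph0.trans_le hκ))) (D := fun Δ : I => Δ.1 ∩ {z | T u w z}ᶜ)
      (fun Δ => Set.Definable.inter (Set.Definable.mono Δ.2.1 Set.subset_union_left)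
        (Set.Definable.compl hTd))
      (fun Δ Δ' => ⟨⟨Δ.1 ∩ Δ'.1, Set.Definable.inter Δ.2.1 Δ'.2.1, Δ.2.2.inter Δ'.2.2⟩,
        fun z hz => ⟨hz.1.1, hz.2⟩, fun z hz => ⟨hz.1.2, hz.2⟩⟩) (fun Δ => hn Δ.1 Δ.2.1 Δ.2.2)
    rw [Set.mem_iInter] at hz
    exact (hz ⟨Set.univ, Set.definable_univ, large_univ⟩).2 (hTP u w z huw
      (realizes_iff.2 fun Δ hΔ hl => (hz ⟨Δ, hΔ, hl⟩).1))
  have hΔP : ∀ x, p.Realizes A x → x ∈ Δ := fun x hx => realizes_iff.1 hx Δ hΔ hΔl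
  let Q : C → C → Prop := fun x y => ∀ z, z ∈ Δ → T x y z
  have hQ : A.Definable L {v : Fin 2 → C | Q (v 0) (v 1)} :=
    definable_forall_fiber (R := {v : Fin 2 ⊕ Fin 1 → C | v (Sum.inr 0) ∈ Δ →
      T (v (Sum.inl 0)) (v (Sum.inl 1)) (v (Sum.inr 0))})
      (definable_imp (definable_of_definable₁ hΔ (Sum.inr 0))
        (hT.preimage_comp ![Sum.inl 0, Sum.inl 1, Sum.inr 0]))
  have hQtrans : ∀ x y z, Q x y → Q y z → Q x z := fun x y z hxy hyz t ht =>
    ⟨fun h1 => (hxy t ht).1 ((hyz t ht).1 h1), fun h1 => (hyz t ht).2 ((hxy t ht).2 h1)⟩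
  have hQlt : ∀ x y, p.Lt A x y → Q x y ∧ ¬ Q y x := by
    intro x y hxy
    refine ⟨fun z hz => ?_, fun hn => ?_⟩
    · obtain ⟨t, ht⟩ := h.1.exists_transfer hκ hC hA huw hxy z
      exact (ht.iff hT).2 (hTΔ t (ht _ (definable_of_definable₁ hΔ 2) hz))
    · have := (hn y (hΔP y hxy.2.1)).1 (hχ₁.2 x y hxy)
      exact hasymm₁ _ _ this this
  refine ⟨fun x y => x = y ∨ (Q x y ∧ ¬ Q y x), ⟨?_, ?_, ?_⟩, ?_⟩
  · exact {
      refl := fun x => Or.inl rfl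
      trans := by
        rintro x y z (rfl | ⟨hxy, hyx⟩) (rfl | ⟨hyz, hzy⟩)
        · exact Or.inl rfl
        · exact Or.inr ⟨hyz, hzy⟩
        · exact Or.inr ⟨hxy, hyx⟩
        · exact Or.inr ⟨hQtrans _ _ _ hxy hyz, fun hzx => hyx (hQtrans _ _ _ hyz hzx)⟩
      antisymm := by
        rintro x y (rfl | ⟨hxy, hyx⟩) hyx'
        · rfl
        · rcases hyx' with rfl | ⟨hyx', -⟩
          · rfl
          · exact (hyx hyx').elim }
  · exact (definable_eq 0 1).union (hQ.inter (definable_of_definable₂ hQ 1 0).compl)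
  · intro I _ a ha i j hij
    have hl := ((h.isMorley_iff h').1 ha).2 i j hij
    exact ⟨Or.inr (hQlt _ _ hl), fun he => h'.lt_irrefl (a j) (by rwa [he] at hl)⟩
  · rintro a b c ha hc hab hbc
    have hab : Q a b := by
      rcases hab with rfl | hab
      exacts [fun z _ => ⟨id, id⟩, hab.1]
    have hbc : Q b c := by
      rcases hbc with rfl | hbc
      exacts [fun z _ => ⟨id, id⟩, hbc.1]
    obtain ⟨d, hda⟩ := h'.exists_lt hκ hC hA ha
    obtain ⟨e, -, he⟩ := exists_forall_lt hκ hC hA {a, c} (by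
      simp only [Finset.mem_insert, Finset.mem_singleton]
      rintro x (rfl | rfl)
      exacts [ha, hc])
    have hae := he a (by simp)
    have hce := he c (by simp)
    obtain ⟨z, hz⟩ := h.1.exists_transfer hκ hC hA huw (h.lt_trans h' hda hae) b
    refine realizes_of_sameTp hz.symm (i := 2) (hP z ?_ ?_)
    · exact hz _ (definable_of_definable₂ hχ.1 0 2) ((hab d (hΔP d hda.1)).2 (hχ₁.2 d a hda)).1
    · exact hz _ (definable_of_definable₂ hχ.1 2 1) ((hbc e (hΔP e hce.2.1)).1 (hχ₁.2 c e hce)).1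

end MorleyRelations

end GlobalType
end AsymType

/-! ### Invariants of models -/

namespace AsymType
namespace GlobalType

section Models

variable {L : FirstOrder.Language.{u, v}} {C : Type w} [L.Structure C] {p : GlobalType L C}
  {A : Set C} {κ : Cardinal.{w}}

/-- A Morley pair, as a sequence with an index type in the universe that a witness quantifies over,
is increasing for the witness. -/
theorem IsWitness.of_lt (h : p.IsWeaklyRegular A) (h' : p.IsAsymmetric A) {r : C → C → Prop}
    (hr : p.IsWitness A r) {x y : C} (hl : p.Lt A x y) : r x y ∧ x ≠ y := by
  let a : ULift.{w} (Fin 2) → C := fun k => ![x, y] k.down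
  have ha : p.IsMorley A a := by
    refine (h.isMorley_iff h').2 ⟨?_, ?_⟩
    · rintro ⟨k⟩
      fin_cases k
      exacts [hl.1, hl.2.1]
    · rintro ⟨k⟩ ⟨l⟩ hkl
      replace hkl : k < l := hkl
      fin_cases k <;> fin_cases l
      · exact (lt_irrefl _ hkl).elim
      · exact hl
      · exact (Nat.not_lt_zero _ hkl).elim
      · exact (lt_irrefl _ hkl).elim
  exact hr.2.2 _ a ha ⟨0⟩ ⟨1⟩ (show (0 : Fin 2) < 1 by decide)

/-- For simple and convex `p`, the classes that meet an elementary substructure are densely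
ordered: on a convex locus the open interval between two elements is definable. -/
theorem denselyOrdered_of_isSimple_of_isConvex (h : p.IsWeaklyRegular A) (h' : p.IsAsymmetric A)
    (hκ : ℵ₀ ≤ κ) (hC : IsSaturated L C κ) (hA : #A < κ) (hs : p.IsSimple A) (hc : p.IsConvex A)
    (M : L.ElementarySubstructure C) (hM : A ⊆ (M : Set C)) (I : Type i) [LinearOrder I]
    (hI : p.InvIs A (M : Set C) I) : DenselyOrdered I := by
  obtain ⟨⟨a, ha⟩, -⟩ := hI
  obtain ⟨ham, haM, hcov⟩ := (isMaximalMorley_iff h h').1 ha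
  obtain ⟨haP, halt⟩ := (h.isMorley_iff h').1 ham
  have hlt : ∀ i j, p.Lt A (a i) (a j) → i < j := by
    intro i j hl
    rcases lt_trichotomy i j with hij | rfl | hij
    · exact hij
    · exact (h'.lt_irrefl _ hl).elim
    · exact (h'.lt_asymm hl (halt j i hij)).elim
  obtain ⟨σ, hσ⟩ := hs
  obtain ⟨r, hr, hconv⟩ := hc
  have hσd : A.Definable L {v : Fin 2 → C | σ.Realize ![v 0, v 1]} :=
    ⟨σ, by simp only [pair_eta]⟩
  have hrd : A.Definable L {v : Fin 2 → C | r (v 0) (v 1)} := hr.2.1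
  refine ⟨fun i j hij => ?_⟩
  obtain ⟨c, hic, hcj⟩ := h.1.exists_between hκ hC hA (halt i j hij)
  have hD : (M : Set C).Definable₁ L ({z | r (a i) z} ∩ ({z | r z (a j)} ∩
      ({z | σ.Realize ![a i, z]}ᶜ ∩ {z | σ.Realize ![z, a j]}ᶜ))) :=
    Set.Definable.inter (definable₁_left hM hrd (haM i)) (Set.Definable.inter
      (definable₁_right hM hrd (haM j)) (Set.Definable.inter
        (Set.Definable.compl (definable₁_left (χ := fun x y => σ.Realize ![x, y]) hM hσd (haM i)))
        (Set.Definable.compl (definable₁_right (χ := fun x y => σ.Realize ![x, y]) hM hσd (haM j)))))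
  have hmeet := fun hne => M.meetsDefinable _ hne hD
  obtain ⟨z, ⟨hiz, hzj, hz1, hz2⟩, hzM⟩ := hmeet ⟨c, (hr.of_lt h h' hic).1,
    (hr.of_lt h h' hcj).1, fun hn => (memE_iff.1 ((hσ _ _ hic.1 hic.2.1).1 hn)).2.2.1 hic,
    fun hn => (memE_iff.1 ((hσ _ _ hcj.1 hcj.2.1).1 hn)).2.2.1 hcj⟩
  have hzP : p.Realizes A z := hconv _ _ _ (haP i) (haP j) hiz hzj
  -- The witness of the asymmetry decides on which side of `a i` and of `a j` the element `z` lies.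
  have hlt_of : ∀ x y, p.Realizes A x → p.Realizes A y → r x y → ¬ σ.Realize ![x, y] →
      p.Lt A x y := by
    intro x y hx hy hxy hn
    by_contra hl
    refine hn ((hσ x y hx hy).2 (memE_iff.2 ⟨hx, hy, hl, fun hl' => ?_⟩))
    have := hr.of_lt h h' hl'
    exact this.2 (hr.1.antisymm _ _ this.1 hxy)
  have h1 := hlt_of _ _ (haP i) hzP hiz hz1
  have h2 := hlt_of _ _ hzP (haP j) hzj hz2
  obtain ⟨k, hk⟩ := hcov z hzM hzP
  rw [memE_iff] at hk
  exact ⟨k, hlt _ _ ((h.lt_or_lt h1 hk.2.1).resolve_right hk.2.2.2),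
    hlt _ _ ((h.lt_or_lt h2 hk.2.1).resolve_left hk.2.2.1)⟩

variable (p A) in
/-- The elements of the locus outside of the classes of the entries of `a`. -/
def gapSet {I : Type*} (a : I → C) : Set C :=
  {z | p.Realizes A z ∧ ∀ i, ¬ p.MemE A z (a i)}

variable (p A) in
/-- The definable sets whose intersection is the set of the elements of the locus outside of the
classes of the entries of `a`. -/
def gapFamily {I : Type*} (a : I → C) :
    {D : Set C // A.Definable₁ L D ∧ p.Large D} ⊕ (I × {χ : C → C → Prop // p.IsMorleyRel A χ}) →
      Set C :=
  Sum.elim Subtype.val fun iχ => {z | iχ.2.1 z (a iχ.1) ∨ iχ.2.1 (a iχ.1) z}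

theorem iInter_gapFamily (h' : p.IsAsymmetric A) {I : Type*} {a : I → C}
    (ha : ∀ i, p.Realizes A (a i)) : ⋂ j, gapFamily p A a j = gapSet p A a := by
  ext z
  rw [Set.mem_iInter]
  constructor
  · intro hz
    refine ⟨realizes_iff.2 fun D hD hl => hz (Sum.inl ⟨D, hD, hl⟩), fun i hi => ?_⟩
    rw [memE_iff] at hi
    obtain ⟨χ, hχ, hn⟩ := h'.exists_isMorleyRel hi.2.2.1
    obtain ⟨χ', hχ', hn'⟩ := h'.exists_isMorleyRel hi.2.2.2
    rcases hz (Sum.inr (i, ⟨_, hχ.and hχ'⟩)) with hz | hz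
    exacts [hn hz.1, hn' hz.2]
  · rintro ⟨hzP, hz⟩ (D | ⟨i, χ⟩)
    · exact realizes_iff.1 hzP D.1 D.2.1 D.2.2
    · have hi := hz i
      rw [memE_iff] at hi
      push Not at hi
      by_cases hl : p.Lt A z (a i)
      · exact Or.inl (χ.2.2 _ _ hl)
      · exact Or.inr (χ.2.2 _ _ (hi hzP (ha i) hl))

/-- A Morley sequence `a` is maximal in a suitable countable model if the type of an element of the
locus outside of the classes of its entries is not isolated. -/
theorem exists_invIs_of_nonIsolated (h : p.IsWeaklyRegular A) (h' : p.IsAsymmetric A)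
    (hκ : ℵ₀ < κ) (hC : IsSaturated L C κ) (hL : L.card ≤ ℵ₀) (hAc : A.Countable) {I : Type i}
    [LinearOrder I] [Countable I] {a : I → C} (ha : p.IsMorley A a)
    (hn : NonIsolated L (gapSet p A a) (A ∪ Set.range a)) :
    ∃ M : L.ElementarySubstructure C, A ⊆ (M : Set C) ∧ (M : Set C).Countable ∧
      p.InvIs A (M : Set C) I := by
  have haP := ((h.isMorley_iff h').1 ha).1
  rw [← iInter_gapFamily h' haP] at hn
  obtain ⟨M, hM, hMc, hMG⟩ := hn.exists_elementarySubstructure hκ hC hL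
    (hAc.union (Set.countable_range a)) (by
      rintro (D | ⟨i, χ⟩)
      · exact Set.Definable.mono D.2.1 Set.subset_union_left
      · exact Set.Definable.union
          (definable₁_right Set.subset_union_left χ.2.1 (Or.inr ⟨i, rfl⟩))
          (definable₁_left Set.subset_union_left χ.2.1 (Or.inr ⟨i, rfl⟩)))
  rw [iInter_gapFamily h' haP] at hMG
  refine ⟨M, Set.subset_union_left.trans hM, hMc, IsMaximalMorley.invIs h h' (a := a)
    ((isMaximalMorley_iff h h').2 ⟨ha, fun i => hM (Or.inr ⟨i, rfl⟩), fun x hx hxP => ?_⟩)⟩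
  by_contra! hn
  exact hMG x hx ⟨hxP, hn⟩

/-- If an isolating set exists, then the gaps of `a` include an interval of the Morley order, in a
definable manner, and unless `a` is empty one of its entries is an end point. -/
theorem exists_interval_of_isolated (h : p.IsWeaklyRegular A) (h' : p.IsAsymmetric A)
    (hκ : ℵ₀ ≤ κ) (hC : IsSaturated L C κ) (hA : #A < κ) {I : Type i} [LinearOrder I] {a : I → C}
    (ha : p.IsMorley A a) (hn : ¬ NonIsolated L (gapSet p A a) (A ∪ Set.range a)) :
    ∃ u w χ, p.Lt A u w ∧ p.IsMorleyRel A χ ∧ (∀ z, χ u z → χ z w → z ∈ gapSet p A a) ∧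
      (Nonempty I → ∃ i, u = a i ∨ w = a i) := by
  classical
  obtain ⟨haP, halt⟩ := (h.isMorley_iff h').1 ha
  rw [NonIsolated] at hn
  push Not at hn
  obtain ⟨D, hD, hne, hDK⟩ := hn
  obtain ⟨F₀, hF₀, hd⟩ := Set.definable_iff_finitely_definable.1 hD
  -- A nonempty finite set of entries suffices to define `D`, unless there are no entries.
  obtain ⟨F, hF, hDF, hFne⟩ : ∃ F : Finset C, (F : Set C) ⊆ Set.range a ∧
      (A ∪ F).Definable₁ L D ∧ (Nonempty I → F.Nonempty) := by
    have hsub : (F₀ : Set C) ⊆ A ∪ (F₀.filter (· ∈ Set.range a) : Finset C) := by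
      intro x hx
      rcases hF₀ hx with hxA | hxa
      · exact Or.inl hxA
      · exact Or.inr (Finset.mem_coe.2 (Finset.mem_filter.2 ⟨hx, hxa⟩))
    have hsub' : ((F₀.filter (· ∈ Set.range a) : Finset C) : Set C) ⊆ Set.range a :=
      fun x hx => (Finset.mem_filter.1 (Finset.mem_coe.1 hx)).2
    by_cases hI : Nonempty I
    · obtain ⟨i⟩ := hI
      refine ⟨insert (a i) (F₀.filter (· ∈ Set.range a)), ?_, Set.Definable.mono hd (hsub.trans ?_),
        fun _ => Finset.insert_nonempty _ _⟩
      · rw [Finset.coe_insert]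
        exact Set.insert_subset ⟨i, rfl⟩ hsub'
      · rw [Finset.coe_insert]
        exact Set.union_subset_union_right _ (Set.subset_insert _ _)
    · exact ⟨_, hsub', Set.Definable.mono hd hsub, fun hI' => (hI hI').elim⟩
  obtain ⟨u, w, χ, huw, hχ, hsub, huwF⟩ := exists_interval_subset h h' hκ hC hA (F := F) (by
      intro f hf g hg hfg
      obtain ⟨i, rfl⟩ := hF hf
      obtain ⟨j, rfl⟩ := hF hg
      rcases lt_trichotomy i j with hij | rfl | hij
      exacts [Or.inl (halt i j hij), (hfg rfl).elim, Or.inr (halt j i hij)]) hDF hne (by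
      intro z hz
      refine ⟨(hDK hz).1, fun f hf => ?_⟩
      obtain ⟨i, rfl⟩ := hF hf
      have hi := (hDK hz).2 i
      rw [memE_iff] at hi
      push Not at hi
      by_cases hl : p.Lt A z (a i)
      · exact Or.inr hl
      · exact Or.inl (hi (hDK hz).1 (haP i) hl))
  refine ⟨u, w, χ, huw, hχ, fun z h1 h2 => hDK (hsub z h1 h2), fun hI => ?_⟩
  rcases huwF (hFne hI) with hu | hw
  · obtain ⟨i, rfl⟩ := hF hu
    exact ⟨i, Or.inl rfl⟩
  · obtain ⟨i, rfl⟩ := hF hw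
    exact ⟨i, Or.inr rfl⟩

theorem nonIsolated_of_not_isConvex (h : p.IsWeaklyRegular A) (h' : p.IsAsymmetric A)
    (hκ : ℵ₀ ≤ κ) (hC : IsSaturated L C κ) (hA : #A < κ) (hc : ¬ p.IsConvex A) {I : Type i}
    [LinearOrder I] {a : I → C} (ha : p.IsMorley A a) :
    NonIsolated L (gapSet p A a) (A ∪ Set.range a) := by
  by_contra hn
  obtain ⟨u, w, χ, huw, hχ, hsub, -⟩ := exists_interval_of_isolated h h' hκ hC hA ha hn
  exact hc (isConvex_of_isMorleyRel h h' hκ hC hA hχ huw fun z h1 h2 => (hsub z h1 h2).1)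

theorem nonIsolated_of_not_isSimple (h : p.IsWeaklyRegular A) (h' : p.IsAsymmetric A)
    (hκ : ℵ₀ ≤ κ) (hC : IsSaturated L C κ) (hA : #A < κ) (hs : ¬ p.IsSimple A) {I : Type i}
    [LinearOrder I] [Nonempty I] {a : I → C} (ha : p.IsMorley A a) :
    NonIsolated L (gapSet p A a) (A ∪ Set.range a) := by
  by_contra hn
  obtain ⟨u, w, χ, huw, hχ, hsub, hI⟩ := exists_interval_of_isolated h h' hκ hC hA ha hn
  refine hs (isSimple_of_isMorleyRel h h' hκ hC hA hχ huw ?_)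
  obtain ⟨i, rfl | rfl⟩ := hI inferInstance
  · exact Or.inl fun z h1 h2 => (hsub z h1 h2).2 i
  · exact Or.inr fun z h1 h2 => (hsub z h1 h2).2 i

/-- For the empty sequence the gap set is the whole locus, which is isolated only if the restriction
of `p` to `A` is. -/
theorem nonIsolated_of_not_isIsolatedOver (hi : ¬ p.IsIsolatedOver A) {I : Type i} [IsEmpty I]
    (a : I → C) : NonIsolated L (gapSet p A a) (A ∪ Set.range a) := by
  rw [Set.range_eq_empty, Set.union_empty]
  rintro D hD ⟨c, hc⟩ hsub
  have hl := ((hsub hc).1.mem_iff hD).1 hc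
  obtain ⟨ψ, rfl⟩ := exists_formula_of_definable₁ hD
  exact hi ⟨ψ, mem_restrict_iff.2 hl, fun c hc => (hsub hc).1⟩

end Models

end GlobalType
end AsymType

theorem mainTheorem1 {L : FirstOrder.Language.{u, v}} {C : Type w} [L.Structure C]
    (κ : Cardinal.{w}) (hκ : ℵ₀ < κ)
    (hL : Cardinal.lift.{w} L.card < Cardinal.lift.{max u v} κ)
    (hC : AsymType.IsSaturated L C κ)
    (A : Set C) (hA : #A < κ)
    (p : AsymType.GlobalType L C)
    (hreg : p.IsWeaklyRegular A) (hasym : p.IsAsymmetric A) :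
    (∀ X : Set C, ∃ (I : Type w) (_ : LinearOrder I), p.InvIs A X I) ∧
    (p.IsSimple A → p.IsConvex A →
      ∀ M : L.ElementarySubstructure C, A ⊆ (M : Set C) →
        ∀ (I : Type i) [LinearOrder I], p.InvIs A (M : Set C) I → Nontrivial I →
          DenselyOrdered I) ∧
    (L.card ≤ ℵ₀ → A.Countable → p.IsSimple A → ¬ p.IsConvex A →
      ∀ (I : Type i) [LinearOrder I] [Countable I],
        ∃ M : L.ElementarySubstructure C, A ⊆ (M : Set C) ∧ (M : Set C).Countable ∧
          p.InvIs A (M : Set C) I) ∧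
    (L.card ≤ ℵ₀ → A.Countable → ¬ p.IsSimple A →
      ∀ (I : Type i) [LinearOrder I] [Countable I], (Nonempty I ∨ ¬ p.IsIsolatedOver A) →
        ∃ M : L.ElementarySubstructure C, A ⊆ (M : Set C) ∧ (M : Set C).Countable ∧
          p.InvIs A (M : Set C) I) := by
  refine ⟨fun X => AsymType.GlobalType.exists_invIs hreg hasym X, ?_, ?_, ?_⟩
  · intro hs hc M hM I _ hI _
    exact AsymType.GlobalType.denselyOrdered_of_isSimple_of_isConvex hreg hasym hκ.le hC hA hs hc
      M hM I hI
  · intro hLc hAc _ hc I _ _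
    obtain ⟨a, ha⟩ := AsymType.GlobalType.exists_isMorley hreg hasym hκ.le hC hA I
    exact AsymType.GlobalType.exists_invIs_of_nonIsolated hreg hasym hκ hC hLc hAc ha
      (AsymType.GlobalType.nonIsolated_of_not_isConvex hreg hasym hκ.le hC hA hc ha)
  · intro hLc hAc hs I _ _ hI
    obtain ⟨a, ha⟩ := AsymType.GlobalType.exists_isMorley hreg hasym hκ.le hC hA I
    refine AsymType.GlobalType.exists_invIs_of_nonIsolated hreg hasym hκ hC hLc hAc ha ?_
    rcases isEmpty_or_nonempty I with hIe | hIne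
    · exact AsymType.GlobalType.nonIsolated_of_not_isIsolatedOver
        (hI.resolve_left (not_nonempty_iff.2 hIe)) a
    · exact AsymType.GlobalType.nonIsolated_of_not_isSimple hreg hasym hκ.le hC hA hs ha
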